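/- A lattice in $\mathbb{R}^n$ is a discrete additive subgroup of $\mathbb{R}^n$ that spans $\mathbb{R}^n$ as a real vector space. A lattice sphere packing in $\mathbb{R}^n$ is a family of closed Euclidean balls $\overline{B}(x,r)$, $x\in L$, of one common radius $r>0$, centred at the points of a lattice $L\subset\mathbb{R}^n$ and with pairwise disjoint interiors. Its density is the proportion of space that it covers, that is, $$\delta=\lim_{R\to\infty}\frac{\operatorname{vol}\Bigl(\overline{B}(0,R)\cap\bigcup_{x\in L}\overline{B}(x,r)\Bigr)}{\operatorname{vol}\bigl(\overline{B}(0,R)\bigr)}.$$ **Theorem (Ball).** For every integer $n\ge 1$ there is a lattice sphere packing in $\mathbb{R}^n$ whose density exists and is at least $$2(n-1)2^{-n}\zeta(n),$$ where $\zeta$ is the Riemann zeta function and where, for $n=1$, the product $(n-1)\zeta(n)$ is read as its limit value $\lim_{s\to1}(s-1)\zeta(s)=1$, so that the bound is then $1$. -/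

import Mathlib

open Filter Topology MeasureTheory

/-- A lattice sphere packing in Euclidean space `ℝⁿ`: closed balls of one common positive radius,
centred at all the points of a (full-rank) lattice, with pairwise disjoint interiors. -/
structure LatticeSpherePacking (n : ℕ) where
  /-- the lattice of centres -/
  lattice : Submodule ℤ (EuclideanSpace ℝ (Fin n))
  discrete : DiscreteTopology lattice
  isZLattice : IsZLattice ℝ lattice
  /-- the common radius of the balls -/
  radius : ℝ
  radius_pos : 0 < radius
  disjoint_interiors : (lattice : Set (EuclideanSpace ℝ (Fin n))).PairwiseDisjoint
    fun x => interior (Metric.closedBall x radius)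

namespace LatticeSpherePacking

/-- The part of space covered by the balls of the packing. -/
def covered {n : ℕ} (P : LatticeSpherePacking n) : Set (EuclideanSpace ℝ (Fin n)) :=
  ⋃ x ∈ P.lattice, Metric.closedBall x P.radius

/-- The packing has density `δ`: the proportion of the ball of radius `R` about the origin that is
covered by the packing tends to `δ` as `R → ∞`. -/
def HasDensity {n : ℕ} (P : LatticeSpherePacking n) (δ : ℝ) : Prop :=
  Tendsto (fun R : ℝ =>
      volume.real (P.covered ∩ Metric.closedBall 0 R) /
        volume.real (Metric.closedBall (0 : EuclideanSpace ℝ (Fin n)) R))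
    atTop (𝓝 δ)

end LatticeSpherePacking

/-! If `T` is admissible, the balls of radius 1/2 about `T ℤⁿ` form a packing of density `2⁻ⁿ V /
|det T|`, with `V` the volume of the unit ball. The aim is an admissible `T` of small determinant.

Write `n = d + 1` with `d ≥ 1` and take `T (z, k) = (z / N, β (⟨q, z⟩ + k))`, of determinant `D = β
/ N ^ d`. Only primitive `(z, k)` need checking. For `0 < |z / N| < 1` the requirement is that `q`
avoid the plank `|⟨q, z⟩ + k| < η z`, where `η z = √(1 - |z / N|²) / β`. Bang's sign argument gives
such a `q` as a signed combination of the `z` (`exists_forall_le_abs_dotProduct_add`), provided that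
the sum of `η z` times the density of integers coprime to `gcd z` is less than `d`. Cancellation
between `k` and `-k`, together with the cubic symmetry of the set of `z`, bounds `|q|` independently
of the range of `k`, so finitely many planks suffice.

By Möbius inversion and Riemann sums, as `N → ∞` with `D` fixed the condition becomes `I / ζ(n) < d
D`, where `I` is the integral of the height of the unit half-ball and `V = 2 I`
(`tendsto_sum_capHeight_div`). Thus every `D > I / (d ζ(n))` is attained. A compactness argument
(`exists_isAdmissible_abs_det_eq`) attains the endpoint, whose density is exactly `2 d 2⁻ⁿ ζ(n)`.
For `n = 1` the lattice of integers gives density 1. -/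

/-- A square matrix is admissible if it maps no nonzero integer vector into the open unit ball. -/
def IsAdmissible {n : ℕ} (T : Matrix (Fin n) (Fin n) ℝ) : Prop :=
  ∀ z : Fin n → ℤ, z ≠ 0 →
    1 ≤ T.mulVec (fun i => (z i : ℝ)) ⬝ᵥ T.mulVec (fun i => (z i : ℝ))

/-! ### Density of a lattice packing -/

namespace LatticeSpherePacking

variable {n : ℕ} (P : LatticeSpherePacking n)

theorem pairwiseDisjoint_ball :
    (P.lattice : Set (EuclideanSpace ℝ (Fin n))).PairwiseDisjoint
      fun x => Metric.ball x P.radius := by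
  have h := P.disjoint_interiors
  simpa only [interior_closedBall _ P.radius_pos.ne'] using h

theorem finite_closedBall_inter_lattice (R : ℝ) :
    (Metric.closedBall 0 R ∩ (P.lattice : Set (EuclideanSpace ℝ (Fin n)))).Finite := by
  have := P.discrete
  exact Metric.finite_isBounded_inter_isClosed DiscreteTopology.isDiscrete
    Metric.isBounded_closedBall (AddSubgroup.isClosed_of_discrete (H := P.lattice.toAddSubgroup))

/-- Lattice points are counted with the gauge `‖x‖ ^ n`, homogeneous of degree `n`. A bounded shift
`c` of the radius does not matter, since `((R + c) / R) ^ n → 1`. -/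
theorem tendsto_card_closedBall_div (hn : 1 ≤ n) (c : ℝ) :
    Tendsto (fun R : ℝ => (Nat.card
      (Metric.closedBall 0 (R + c) ∩ (P.lattice : Set (EuclideanSpace ℝ (Fin n))) : Set _) : ℝ)
        / R ^ n) atTop
      (𝓝 (volume.real (Metric.closedBall (0 : EuclideanSpace ℝ (Fin n)) 1) /
        ZLattice.covolume P.lattice)) := by
  have := P.discrete
  have := P.isZLattice
  have : Nonempty (Fin n) := ⟨⟨0, hn⟩⟩
  have hset : ∀ R : ℝ, 0 ≤ R → {x : EuclideanSpace ℝ (Fin n) | x ∈ Set.univ ∧ ‖x‖ ^ n ≤ R ^ n}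
      = Metric.closedBall 0 R := by
    intro R hR
    ext x
    simp [pow_le_pow_iff_left₀ (norm_nonneg x) hR (by omega : n ≠ 0)]
  have hset1 := hset 1 zero_le_one
  rw [one_pow] at hset1
  have h := ZLattice.covolume.tendsto_card_le_div' P.lattice (X := Set.univ)
    (F := fun x => ‖x‖ ^ n) (fun _ _ _ _ => Set.mem_univ _)
    (fun x r hr => by
      rw [norm_smul, mul_pow, Real.norm_of_nonneg hr, finrank_euclideanSpace_fin])
    (by rw [hset1]; exact Metric.isBounded_closedBall)
    (by rw [hset1]; exact Metric.isClosed_closedBall.measurableSet)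
    (by rw [hset1]; exact (convex_closedBall _ _).addHaar_frontier _)
  rw [hset1] at h
  have hpow : Tendsto (fun R : ℝ => (R + c) ^ n) atTop atTop :=
    (tendsto_pow_atTop (by omega)).comp (tendsto_atTop_add_const_right _ c tendsto_id)
  have h1 := h.comp hpow
  have h2 : Tendsto (fun R : ℝ => ((R + c) / R) ^ n) atTop (𝓝 1) := by
    have : Tendsto (fun R : ℝ => 1 + c / R) atTop (𝓝 (1 + 0)) :=
      tendsto_const_nhds.add (tendsto_const_nhds.div_atTop tendsto_id)
    have h3 := this.pow n
    rw [add_zero, one_pow] at h3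
    refine h3.congr' ?_
    filter_upwards [eventually_gt_atTop 0] with R hR
    rw [add_div, div_self hR.ne']
  have h3 := h1.mul h2
  rw [mul_one] at h3
  refine h3.congr' ?_
  filter_upwards [eventually_gt_atTop 0, eventually_gt_atTop (-c)] with R hR hR'
  have hRc : 0 < R + c := by linarith
  simp only [Function.comp]
  rw [hset _ hRc.le, div_pow]
  field_simp

/-- A lattice packing has a density, given by the volume of a ball over the covolume. -/
theorem hasDensity (hn : 1 ≤ n) :
    P.HasDensity (volume.real (Metric.closedBall (0 : EuclideanSpace ℝ (Fin n)) P.radius) /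
      ZLattice.covolume P.lattice) := by
  set E := EuclideanSpace ℝ (Fin n)
  have : Nonempty (Fin n) := ⟨⟨0, hn⟩⟩
  have hfr : Module.finrank ℝ E = n := finrank_euclideanSpace_fin
  set v₁ := volume.real (Metric.ball (0 : E) 1)
  have hv₁ : 0 < v₁ := ENNReal.toReal_pos (Metric.measure_ball_pos _ _ one_pos).ne'
    measure_ball_lt_top.ne
  have hball : ∀ (x : E) {r : ℝ}, 0 ≤ r → volume.real (Metric.closedBall x r) = r ^ n * v₁ := by
    intro x r hr
    rw [Measure.addHaar_real_closedBall _ _ hr, hfr]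
  have hball' : ∀ x : E, volume.real (Metric.ball x P.radius) = P.radius ^ n * v₁ := by
    intro x
    rw [measureReal_def, ← Measure.addHaar_closedBall_eq_addHaar_ball, ← measureReal_def,
      hball x P.radius_pos.le]
  have hlim : ∀ c : ℝ, Tendsto (fun R : ℝ => (Nat.card
      (Metric.closedBall 0 (R + c) ∩ (P.lattice : Set E) : Set _) : ℝ) * (P.radius ^ n * v₁)
        / volume.real (Metric.closedBall (0 : E) R)) atTop
      (𝓝 (volume.real (Metric.closedBall (0 : E) P.radius) / ZLattice.covolume P.lattice)) := by
    intro c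
    have h := (P.tendsto_card_closedBall_div hn c).mul_const (P.radius ^ n)
    rw [hball _ zero_le_one, one_pow, one_mul] at h
    rw [hball _ P.radius_pos.le, mul_comm (P.radius ^ n), ← div_mul_eq_mul_div]
    refine h.congr' ?_
    filter_upwards [eventually_gt_atTop 0] with R hR
    rw [hball _ hR.le]
    field_simp
  -- Balls centred within `R - r` of the origin lie inside the large ball and have disjoint
  -- interiors; balls meeting the large ball are centred within `R + r`. Both counts have the same
  -- limit.
  refine tendsto_of_tendsto_of_tendsto_of_le_of_le (hlim (-P.radius)) (hlim P.radius) ?_ ?_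
  · intro R
    refine div_le_div_of_nonneg_right ?_ measureReal_nonneg
    have hfin := P.finite_closedBall_inter_lattice (R + -P.radius)
    rw [Nat.card_coe_set_eq, Set.ncard_eq_toFinset_card _ hfin, ← nsmul_eq_mul,
      ← Finset.sum_const, ← Finset.sum_congr rfl fun x _ => hball' x,
      ← measureReal_biUnion_finset]
    · refine measureReal_mono ?_
        ((measure_mono Set.inter_subset_right).trans_lt measure_closedBall_lt_top).ne
      intro y hy
      simp only [Set.mem_iUnion, Set.Finite.mem_toFinset] at hy
      obtain ⟨x, ⟨hx1, hx2⟩, hy⟩ := hy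
      refine ⟨Set.mem_iUnion₂.2 ⟨x, hx2, Metric.ball_subset_closedBall hy⟩, ?_⟩
      rw [Metric.mem_closedBall] at hx1 ⊢
      rw [Metric.mem_ball] at hy
      linarith [dist_triangle y x 0]
    · intro x hx y hy hxy
      simp only [Set.Finite.coe_toFinset] at hx hy
      exact P.pairwiseDisjoint_ball hx.2 hy.2 hxy
    · exact fun _ _ => measurableSet_ball
  · intro R
    refine div_le_div_of_nonneg_right ?_ measureReal_nonneg
    have hfin := P.finite_closedBall_inter_lattice (R + P.radius)
    rw [Nat.card_coe_set_eq, Set.ncard_eq_toFinset_card _ hfin, ← nsmul_eq_mul,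
      ← Finset.sum_const, ← Finset.sum_congr rfl fun x _ => hball x P.radius_pos.le]
    refine le_trans (measureReal_mono ?_ ?_) (measureReal_biUnion_finset_le _ _)
    · rintro y ⟨hy, hyR⟩
      obtain ⟨x, hx, hy⟩ := Set.mem_iUnion₂.1 hy
      refine Set.mem_iUnion₂.2 ⟨x, ?_, hy⟩
      rw [Set.Finite.mem_toFinset]
      refine ⟨?_, hx⟩
      rw [Metric.mem_closedBall] at hy hyR ⊢
      rw [dist_comm] at hy
      linarith [dist_triangle x y 0]
    · exact (measure_biUnion_lt_top (Finset.finite_toSet _)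
        fun _ _ => measure_closedBall_lt_top).ne

end LatticeSpherePacking

/-! ### From admissible matrices to packings -/

theorem ZLattice.covolume_span_basis {n : ℕ}
    (b : Module.Basis (Fin n) ℝ (EuclideanSpace ℝ (Fin n))) :
    ZLattice.covolume (Submodule.span ℤ (Set.range b)) =
      |(Matrix.of fun i j => b j i).det| := by
  rw [ZLattice.covolume_eq_det_mul_measureReal _ _ (b.restrictScalars ℤ)
    (EuclideanSpace.basisFun (Fin n) ℝ).toBasis]
  have h1 : volume.real (ZSpan.fundamentalDomain (EuclideanSpace.basisFun (Fin n) ℝ).toBasis) = 1 := by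
    rw [measureReal_congr (ZSpan.fundamentalDomain_ae_parallelepiped _ volume), measureReal_def,
      OrthonormalBasis.coe_toBasis, OrthonormalBasis.volume_parallelepiped, ENNReal.toReal_one]
  rw [h1, mul_one, Module.Basis.det_apply]
  congr 2
  ext i j
  simp [Module.Basis.toMatrix_apply]

/-- An admissible matrix yields a lattice packing by balls of radius `1 / 2`. -/
theorem exists_packing_of_isAdmissible {n : ℕ} (hn : 1 ≤ n) (T : Matrix (Fin n) (Fin n) ℝ)
    (hdet : T.det ≠ 0) (hT : IsAdmissible T) :
    ∃ P : LatticeSpherePacking n, P.HasDensity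
      (volume.real (Metric.closedBall (0 : EuclideanSpace ℝ (Fin n)) (1 / 2)) / |T.det|) := by
  set e := (WithLp.linearEquiv 2 ℝ (Fin n → ℝ)).symm
  set b : Module.Basis (Fin n) ℝ (EuclideanSpace ℝ (Fin n)) :=
    ((Pi.basisFun ℝ (Fin n)).map (Matrix.toLin'OfInv (M := T⁻¹) (M' := T)
      (Matrix.nonsing_inv_mul _ hdet.isUnit) (Matrix.mul_nonsing_inv _ hdet.isUnit))).map e with hb
  have hbij : ∀ i j, b j i = T i j := by
    intro i j
    simp [hb, e]
  have hmin : ∀ x ∈ Submodule.span ℤ (Set.range b), x ≠ 0 → 1 ≤ ‖x‖ := by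
    intro x hx hx0
    obtain ⟨z, rfl⟩ := (Submodule.mem_span_range_iff_exists_fun ℤ).1 hx
    have hz : z ≠ 0 := by rintro rfl; simp at hx0
    have h := hT z hz
    have h2 : ‖∑ i, z i • b i‖ ^ 2 = T.mulVec (fun i => (z i : ℝ)) ⬝ᵥ T.mulVec (fun i => (z i : ℝ)) := by
      rw [EuclideanSpace.norm_sq_eq, dotProduct]
      refine Finset.sum_congr rfl fun i _ => ?_
      simp [hbij, Matrix.mulVec, dotProduct, ← sq, mul_comm]
    rw [← h2] at h
    nlinarith [norm_nonneg (∑ i, z i • b i)]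
  have hdisc : DiscreteTopology (Submodule.span ℤ (Set.range b)) := inferInstance
  have hZ : IsZLattice ℝ (Submodule.span ℤ (Set.range b)) := inferInstance
  refine ⟨⟨_, hdisc, hZ, 1 / 2, by norm_num, ?_⟩, ?_⟩
  · intro x hx y hy hxy
    simp only [Function.onFun]
    rw [interior_closedBall _ (by norm_num), interior_closedBall _ (by norm_num)]
    refine Metric.ball_disjoint_ball ?_
    have := hmin (x - y) (Submodule.sub_mem _ hx hy) (sub_ne_zero.2 hxy)
    rw [dist_eq_norm]
    linarith
  · convert LatticeSpherePacking.hasDensity _ hn using 2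
    simp only
    rw [ZLattice.covolume_span_basis]
    congr 2
    ext i j
    simp [hbij]

/-! ### Compactness: limits of admissible lattices -/

/-- Minkowski's convex body theorem for the lattice `T ℤⁿ`. -/
theorem exists_int_mulVec_mem_of_convex {n : ℕ} (T : Matrix (Fin n) (Fin n) ℝ) (hdet : T.det ≠ 0)
    {s : Set (Fin n → ℝ)} (hsymm : ∀ x ∈ s, -x ∈ s) (hconv : Convex ℝ s)
    (hvol : 2 ^ n * ENNReal.ofReal |T.det| < volume s) :
    ∃ z : Fin n → ℤ, z ≠ 0 ∧ T.mulVec (fun i => (z i : ℝ)) ∈ s := by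
  have hT : LinearMap.det (Matrix.toLin' T) ≠ 0 := by rwa [LinearMap.det_toLin']
  have hF : volume (ZSpan.fundamentalDomain (Pi.basisFun ℝ (Fin n))) = 1 := by
    rw [ZSpan.volume_fundamentalDomain]
    have : Matrix.of (Pi.basisFun ℝ (Fin n)) = 1 := by
      ext i j
      simp [Matrix.one_apply, Pi.single_apply, eq_comm]
    simp [this]
  have hvol' : volume (ZSpan.fundamentalDomain (Pi.basisFun ℝ (Fin n))) *
      2 ^ Module.finrank ℝ (Fin n → ℝ) < volume (Matrix.toLin' T ⁻¹' s) := by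
    rw [hF, one_mul, Measure.addHaar_preimage_linearMap _ hT, LinearMap.det_toLin', abs_inv,
      ENNReal.ofReal_inv_of_pos (abs_pos.2 hdet), Module.finrank_fin_fun, mul_comm,
      ← div_eq_mul_inv, ENNReal.lt_div_iff_mul_lt]
    · exact hvol
    · left; simpa using hdet
    · left; exact ENNReal.ofReal_ne_top
  have : Countable (Submodule.span ℤ (Set.range (Pi.basisFun ℝ (Fin n)))).toAddSubgroup :=
    inferInstanceAs (Countable (Submodule.span ℤ (Set.range (Pi.basisFun ℝ (Fin n)))))
  obtain ⟨⟨x, hx⟩, hx0, hxs⟩ := exists_ne_zero_mem_lattice_of_measure_mul_two_pow_lt_measure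
    (L := (Submodule.span ℤ (Set.range (Pi.basisFun ℝ (Fin n)))).toAddSubgroup)
    (ZSpan.isAddFundamentalDomain (Pi.basisFun ℝ (Fin n)) volume)
    (fun x hx => by
      rw [Set.mem_preimage, map_neg]
      exact hsymm _ hx) (hconv.linear_preimage _) hvol'
  have hx' := (Module.Basis.mem_span_iff_repr_mem ℤ (Pi.basisFun ℝ (Fin n)) x).1 hx
  choose z hz using hx'
  have hzx : (fun i => (z i : ℝ)) = x := by
    ext i
    simpa using hz i
  refine ⟨z, ?_, ?_⟩
  · rintro rfl
    apply hx0
    ext i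
    simp [← hzx]
  · rw [hzx]
    exact hxs

/-- The limit of the lattices `T j ℤⁿ` along an ultrafilter. -/
def limitLattice {n : ℕ} (T : ℕ → Matrix (Fin n) (Fin n) ℝ) (U : Ultrafilter ℕ) :
    Submodule ℤ (Fin n → ℝ) where
  carrier := {x | ∃ z : ℕ → Fin n → ℤ,
    Tendsto (fun j => (T j).mulVec (fun i => (z j i : ℝ))) U (𝓝 x)}
  add_mem' := by
    rintro x y ⟨z, hz⟩ ⟨w, hw⟩
    refine ⟨fun j => z j + w j, (hz.add hw).congr fun j => ?_⟩
    rw [← Matrix.mulVec_add]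
    congr 1
    ext i
    simp
  zero_mem' := ⟨0, by
    refine tendsto_const_nhds.congr fun j => ?_
    ext i
    simp [Matrix.mulVec, dotProduct]⟩
  smul_mem' := by
    rintro c x ⟨z, hz⟩
    refine ⟨fun j => c • z j, (hz.const_smul c).congr fun j => ?_⟩
    ext i
    simp only [Matrix.mulVec, dotProduct, Pi.smul_apply, Finset.smul_sum, smul_eq_mul,
      zsmul_eq_mul, Int.cast_mul]
    exact Finset.sum_congr rfl fun k _ => by ring

section limitLattice

variable {n : ℕ} {T : ℕ → Matrix (Fin n) (Fin n) ℝ} {U : Ultrafilter ℕ}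

/-- The lower bound on nonzero lattice vectors is a closed condition. The limit may be zero a
priori, so this also shows that nonzero lattice vectors cannot converge to zero, which is the
contradiction used repeatedly below. -/
theorem one_le_dotProduct_of_tendsto (hT : ∀ j, IsAdmissible (T j)) {z : ℕ → Fin n → ℤ}
    {x : Fin n → ℝ} (hx : Tendsto (fun j => (T j).mulVec (fun i => (z j i : ℝ))) U (𝓝 x))
    (hz : ∀ᶠ j in U, z j ≠ 0) : 1 ≤ x ⬝ᵥ x := by
  have hc : Continuous fun y : Fin n → ℝ => y ⬝ᵥ y := by
    unfold dotProduct
    fun_prop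
  refine ge_of_tendsto ((hc.tendsto x).comp hx) ?_
  filter_upwards [hz] with j hj using hT j _ hj

theorem one_le_dotProduct_of_mem_limitLattice (hT : ∀ j, IsAdmissible (T j)) {x : Fin n → ℝ}
    (hx : x ∈ limitLattice T U) (hx0 : x ≠ 0) : 1 ≤ x ⬝ᵥ x := by
  obtain ⟨z, hz⟩ := hx
  refine one_le_dotProduct_of_tendsto hT hz ?_
  filter_upwards [hz.eventually_ne hx0] with j hj h0
  apply hj
  ext i
  simp [h0, Matrix.mulVec, dotProduct]

theorem eq_zero_of_mem_limitLattice_of_norm_le (hT : ∀ j, IsAdmissible (T j)) {x : Fin n → ℝ}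
    (hx : x ∈ limitLattice T U) (hn : ‖x‖ ≤ 1 / (n + 1)) : x = 0 := by
  by_contra h
  have h1 := one_le_dotProduct_of_mem_limitLattice hT hx h
  have h2 : x ⬝ᵥ x ≤ ∑ _i : Fin n, (1 / ((n : ℝ) + 1)) ^ 2 := by
    refine Finset.sum_le_sum fun i _ => ?_
    rw [← sq, ← sq_abs]
    gcongr
    exact (norm_le_pi_norm x i).trans hn
  rw [Finset.sum_const, Finset.card_univ, Fintype.card_fin, nsmul_eq_mul] at h2
  -- The sup-norm radius `1 / (n + 1)` is chosen so that the whole box lies in the open Euclidean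
  -- unit ball.
  have h3 : (n : ℝ) * (1 / (n + 1)) ^ 2 < 1 := by
    rw [div_pow, one_pow, mul_one_div, div_lt_one (by positivity)]
    nlinarith [(Nat.cast_nonneg n : (0 : ℝ) ≤ n)]
  linarith

theorem discreteTopology_limitLattice (hT : ∀ j, IsAdmissible (T j)) :
    DiscreteTopology (limitLattice T U) := by
  refine discreteTopology_of_isOpen_singleton_zero
    (Metric.isOpen_singleton_iff.2 ⟨1 / (n + 1), by positivity, fun y hy => ?_⟩)
  rw [dist_zero_right] at hy
  exact Subtype.ext (eq_zero_of_mem_limitLattice_of_norm_le hT y.2 hy.le)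

theorem exists_mem_limitLattice_of_isCompact {z : ℕ → Fin n → ℤ} {K : Set (Fin n → ℝ)}
    (hK : IsCompact K) (hz : ∀ᶠ j in U, (T j).mulVec (fun i => (z j i : ℝ)) ∈ K) :
    ∃ x ∈ K, Tendsto (fun j => (T j).mulVec (fun i => (z j i : ℝ))) U (𝓝 x) := by
  obtain ⟨x, hxK, hx⟩ := hK.ultrafilter_le_nhds
    (U.map fun j => (T j).mulVec (fun i => (z j i : ℝ))) (by
      rw [le_principal_iff]
      exact hz)
  exact ⟨x, hxK, hx⟩

/-- If the limit lay in a hyperplane `ker f`, a small box stretched transversally to it would have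
volume large enough for Minkowski to give nonzero points of every `T j ℤⁿ` with bounded determinant.
Their limit lies in the stretched box and in `ker f`, hence in the original small box, where no
limit of nonzero lattice vectors can be. -/
theorem isZLattice_limitLattice (hT : ∀ j, IsAdmissible (T j)) {C : ℝ}
    (hdet : ∀ᶠ j in U, (T j).det ≠ 0 ∧ |(T j).det| ≤ C)
    [DiscreteTopology (limitLattice T U)] : IsZLattice ℝ (limitLattice T U) := by
  refine ⟨?_⟩
  by_contra hne
  obtain ⟨f, hf0, hf⟩ := Submodule.exists_le_ker_of_lt_top _ (lt_top_iff_ne_top.2 hne)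
  obtain ⟨v, hv⟩ : ∃ v, f v = 1 := by
    obtain ⟨w, hw⟩ := DFunLike.ne_iff.1 hf0
    exact ⟨(f w)⁻¹ • w, by simpa using inv_mul_cancel₀ hw⟩
  set B := Metric.closedBall (0 : Fin n → ℝ) (1 / (n + 1)) with hB
  have hBpos : 0 < volume B := Metric.measure_closedBall_pos _ _ (by positivity)
  have hBtop : volume B ≠ ⊤ := measure_closedBall_lt_top.ne
  have hBr : 0 < (volume B).toReal := ENNReal.toReal_pos hBpos.ne' hBtop
  -- The stretching factor `1 + c` is what Minkowski's theorem needs for determinants up to `C`.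
  obtain ⟨c, hc0, hc⟩ : ∃ c : ℝ, 0 ≤ c ∧ 2 ^ n * |C| < (1 + c) * (volume B).toReal := by
    refine ⟨2 ^ n * |C| / (volume B).toReal, by positivity, ?_⟩
    rw [add_mul, div_mul_cancel₀ _ hBr.ne']
    linarith
  set A := LinearMap.transvection f (c • v)
  have hA : ∀ x, A x = x + f x • c • v := LinearMap.transvection.apply _ _
  have hAdet : LinearMap.det A = 1 + c := by
    rw [LinearMap.transvection.det]
    simp [hv]
  have hvol : volume (A '' B) = ENNReal.ofReal (1 + c) * volume B := by
    rw [Measure.addHaar_image_linearMap, hAdet, abs_of_pos (by linarith)]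
  have hcpt : IsCompact (A '' B) :=
    (isCompact_closedBall _ _).image (LinearMap.continuous_of_finiteDimensional A)
  have hex : ∀ j, ∃ z : Fin n → ℤ, (T j).det ≠ 0 ∧ |(T j).det| ≤ C →
      z ≠ 0 ∧ (T j).mulVec (fun i => (z i : ℝ)) ∈ A '' B := by
    intro j
    by_cases hj : (T j).det ≠ 0 ∧ |(T j).det| ≤ C
    · obtain ⟨z, hz⟩ := exists_int_mulVec_mem_of_convex (T j) hj.1 (s := A '' B) (by
          rintro _ ⟨x, hx, rfl⟩
          exact ⟨-x, by simpa [hB] using hx, by simp⟩)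
        ((convex_closedBall _ _).linear_image A) (by
          rw [hvol, ← ENNReal.ofReal_toReal hBtop, ← ENNReal.ofReal_mul (by linarith),
            ← ENNReal.ofReal_ofNat 2, ← ENNReal.ofReal_pow zero_le_two,
            ← ENNReal.ofReal_mul (by positivity),
            ENNReal.ofReal_lt_ofReal_iff (by positivity)]
          refine lt_of_le_of_lt ?_ hc
          exact mul_le_mul_of_nonneg_left (hj.2.trans (le_abs_self C)) (by positivity))
      exact ⟨z, fun _ => hz⟩
    · exact ⟨0, fun h => absurd h hj⟩
  choose z hz using hex
  obtain ⟨x, ⟨y, hy, rfl⟩, hx⟩ := exists_mem_limitLattice_of_isCompact (T := T) (z := z) hcpt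
    (hdet.mono fun j hj => (hz j hj).2)
  have hxL : A y ∈ limitLattice T U := ⟨z, hx⟩
  have hx1 := one_le_dotProduct_of_tendsto hT hx (hdet.mono fun j hj => (hz j hj).1)
  have hfx : f (A y) = 0 := hf (Submodule.subset_span hxL)
  have hfy : f y = 0 := by
    rw [hA] at hfx
    simp only [map_add, map_smul, hv, smul_eq_mul, mul_one] at hfx
    have : (1 + c) * f y = 0 := by linarith
    rcases mul_eq_zero.1 this with h | h
    · linarith
    · exact h
  -- The stretch fixes the hyperplane `ker f` pointwise.
  have hAy : A y = y := by rw [hA, hfy]; simp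
  rw [hAy] at hxL hx1
  have := eq_zero_of_mem_limitLattice_of_norm_le hT hxL (by simpa [hB] using hy)
  rw [this] at hx1
  simp at hx1
  linarith

end limitLattice

/-- Compactness for admissible matrices: the limiting determinant is attained. -/
theorem exists_isAdmissible_abs_det_eq {n : ℕ} {T : ℕ → Matrix (Fin n) (Fin n) ℝ}
    (hT : ∀ j, IsAdmissible (T j)) {D : ℝ} (hD : 0 < D)
    (hdet : Tendsto (fun j => (T j).det) atTop (𝓝 D)) :
    ∃ B : Matrix (Fin n) (Fin n) ℝ, IsAdmissible B ∧ |B.det| = D := by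
  -- Along an ultrafilter every bounded sequence converges, so no subsequences need be extracted.
  set U := Ultrafilter.of (atTop : Filter ℕ)
  have hdetU : Tendsto (fun j => (T j).det) U (𝓝 D) := hdet.mono_left (Ultrafilter.of_le _)
  have hdisc : DiscreteTopology (limitLattice T U) := discreteTopology_limitLattice hT
  have hlat : IsZLattice ℝ (limitLattice T U) := by
    refine isZLattice_limitLattice (C := D + 1) hT ?_
    filter_upwards [hdetU.eventually (lt_mem_nhds hD),
      hdetU.eventually (gt_mem_nhds (lt_add_one D))] with j h1 h2
    exact ⟨h1.ne', by rw [abs_of_pos h1]; exact h2.le⟩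
  set b := IsZLattice.basis (limitLattice T U)
  set b' := b.ofZLatticeBasis ℝ
  set B : Matrix (Fin n) (Fin n) ℝ := Matrix.of fun i j => (b j : Fin n → ℝ) i with hBdef
  have hBmul : ∀ c : Fin n → ℝ, B.mulVec c = ∑ i, c i • b' i := by
    intro c
    ext i
    simp [B, b', Matrix.mulVec, dotProduct, mul_comm]
  have hBmem : ∀ z : Fin n → ℤ, B.mulVec (fun i => (z i : ℝ)) ∈ limitLattice T U := by
    intro z
    rw [hBmul]
    refine Submodule.sum_mem _ fun i _ => ?_
    rw [Int.cast_smul_eq_zsmul, Module.Basis.ofZLatticeBasis_apply]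
    exact Submodule.smul_mem _ _ (b i).2
  have hBinj : ∀ c : Fin n → ℝ, B.mulVec c = 0 → c = 0 := by
    intro c hc
    rw [hBmul] at hc
    exact funext (Fintype.linearIndependent_iff.1 b'.linearIndependent c hc)
  have hBint : ∀ c : Fin n → ℝ, B.mulVec c ∈ limitLattice T U → ∀ i, ∃ m : ℤ, c i = m := by
    intro c hc i
    refine ⟨b.repr ⟨_, hc⟩ i, ?_⟩
    rw [← Module.Basis.ofZLatticeBasis_repr_apply ℝ]
    change c i = b'.repr (B.mulVec c) i
    rw [hBmul, b'.repr_sum_self]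
  have hBdet : B.det ≠ 0 := by
    intro h
    obtain ⟨v, hv, hv0⟩ := Matrix.exists_mulVec_eq_zero_iff.2 h
    exact hv (hBinj v hv0)
  refine ⟨B, fun z hz => ?_, ?_⟩
  · refine one_le_dotProduct_of_mem_limitLattice hT (hBmem z) fun h => hz ?_
    have := hBinj _ h
    ext i
    simpa using congrFun this i
  have hZ : ∀ k, ∃ z : ℕ → Fin n → ℤ, Tendsto (fun j => (T j).mulVec (fun i => (z j i : ℝ))) U
      (𝓝 (b k : Fin n → ℝ)) := fun k => (b k).2
  choose z hz using hZ
  set Z : ℕ → Matrix (Fin n) (Fin n) ℤ := fun j => Matrix.of fun i k => z k j i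
  set ZR : ℕ → Matrix (Fin n) (Fin n) ℝ := fun j => (Z j).map (Int.castRingHom ℝ) with hZR
  have hZRdet : ∀ j, (ZR j).det = ((Z j).det : ℝ) := fun j =>
    ((Int.castRingHom ℝ).map_det (Z j)).symm
  -- Each basis vector of the limit is a limit of vectors of `T j ℤⁿ`. Their integer coordinates are
  -- the columns of `Z j`, so `T j * Z j` generates a sublattice of `T j ℤⁿ` and tends to `B`.
  have hTZ : Tendsto (fun j => T j * ZR j) U (𝓝 B) := by
    refine tendsto_pi_nhds.2 fun i => tendsto_pi_nhds.2 fun k => ?_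
    exact tendsto_pi_nhds.1 (hz k) i
  have hTZdet : Tendsto (fun j => (T j).det * ((Z j).det : ℝ)) U (𝓝 B.det) := by
    have hc : Continuous fun M : Matrix (Fin n) (Fin n) ℝ => M.det := continuous_id.matrix_det
    refine ((hc.tendsto B).comp hTZ).congr fun j => ?_
    simp [Matrix.det_mul, hZRdet]
  by_cases hunit : ∀ᶠ j in U, IsUnit (Z j)
  · have h1 : Tendsto (fun j => |(T j).det|) U (𝓝 |B.det|) := by
      refine hTZdet.abs.congr' ?_
      filter_upwards [hunit] with j hj
      have h := Int.isUnit_iff_abs_eq.1 ((Matrix.isUnit_iff_isUnit_det _).1 hj)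
      rw [abs_mul, ← Int.cast_abs, h, Int.cast_one, mul_one]
    have h2 := tendsto_nhds_unique h1 hdetU.abs
    rw [h2, abs_of_pos hD]
  exfalso
  -- If the sublattice is proper, some `y` lies outside `Z j ℤⁿ`. Reducing it modulo `Z j ℤⁿ` makes
  -- its coordinates `c` with respect to `Z j` at most 1/2 in absolute value, while keeping `y ≠ 0`.
  have hnu : ∀ᶠ j in U, ¬ IsUnit (Z j) := Ultrafilter.eventually_not.2 hunit
  have hdne : ∀ᶠ j in U, (Z j).det ≠ 0 := by
    filter_upwards [hTZdet.eventually_ne hBdet] with j hj h0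
    simp [h0] at hj
  have hex : ∀ j, ∃ (y : Fin n → ℤ) (c : Fin n → ℝ), ¬ IsUnit (Z j) ∧ (Z j).det ≠ 0 →
      y ≠ 0 ∧ (∀ i, |c i| ≤ 1 / 2) ∧ (ZR j).mulVec c = fun i => (y i : ℝ) := by
    intro j
    by_cases hj : ¬ IsUnit (Z j) ∧ (Z j).det ≠ 0
    swap
    · exact ⟨0, 0, fun h => absurd h hj⟩
    obtain ⟨y, hy⟩ : ∃ y, ∀ w, (Z j).mulVec w ≠ y := by
      by_contra! h
      exact hj.1 (Matrix.mulVec_surjective_iff_isUnit.1 h)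
    have hdetu : IsUnit (ZR j).det := by
      rw [hZRdet]
      exact (Int.cast_ne_zero.2 hj.2).isUnit
    set p := (ZR j)⁻¹.mulVec (fun i => (y i : ℝ))
    have hp : (ZR j).mulVec p = fun i => (y i : ℝ) := by
      rw [Matrix.mulVec_mulVec, Matrix.mul_nonsing_inv _ hdetu, Matrix.one_mulVec]
    have hcast : ∀ w : Fin n → ℤ, (ZR j).mulVec (fun i => (w i : ℝ)) =
        fun i => (((Z j).mulVec w) i : ℝ) := by
      intro w
      ext i
      simp [hZR, Matrix.mulVec, dotProduct]
    refine ⟨y - (Z j).mulVec fun i => round (p i), fun i => p i - round (p i), fun _ => ⟨?_, ?_, ?_⟩⟩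
    · intro h
      exact hy _ (sub_eq_zero.1 h).symm
    · intro i
      exact abs_sub_round (p i)
    · have : (fun i => p i - (round (p i) : ℝ)) = p - fun i => (round (p i) : ℝ) := rfl
      rw [this, Matrix.mulVec_sub, hp, hcast]
      ext i
      simp
  choose y c hyc using hex
  have hev : ∀ᶠ j in U, y j ≠ 0 ∧ (∀ i, |c j i| ≤ 1 / 2) ∧
      (ZR j).mulVec (c j) = fun i => (y j i : ℝ) := by
    filter_upwards [hnu, hdne] with j h1 h2 using hyc j ⟨h1, h2⟩
  obtain ⟨c₀, hc₀, hlim⟩ := (isCompact_closedBall (0 : Fin n → ℝ) (1 / 2)).ultrafilter_le_nhds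
    (U.map c) (by
      simp only [le_principal_iff, Ultrafilter.coe_map, mem_map]
      filter_upwards [hev] with j hj
      rw [Set.mem_preimage, mem_closedBall_zero_iff, pi_norm_le_iff_of_nonneg (by norm_num)]
      exact hj.2.1)
  have hlim' : Tendsto c U (𝓝 c₀) := hlim
  have hconv : Tendsto (fun j => (T j).mulVec (fun i => (y j i : ℝ))) U (𝓝 (B.mulVec c₀)) := by
    have hc : Continuous fun q : Matrix (Fin n) (Fin n) ℝ × (Fin n → ℝ) => q.1.mulVec q.2 :=
      continuous_fst.matrix_mulVec continuous_snd
    refine ((hc.tendsto (B, c₀)).comp (hTZ.prodMk_nhds hlim')).congr' ?_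
    filter_upwards [hev] with j hj
    simp only [Function.comp]
    rw [← hj.2.2, Matrix.mulVec_mulVec]
  have h1 := one_le_dotProduct_of_tendsto hT hconv (hev.mono fun j hj => hj.1)
  -- The vector `B c₀` belongs to the limit lattice, so `c₀` is integral; its entries are at most
  -- 1/2, so it vanishes. Nonzero lattice vectors would then tend to zero.
  have hc0 : c₀ = 0 := by
    ext i
    obtain ⟨m, hm⟩ := hBint c₀ ⟨y, hconv⟩ i
    rw [mem_closedBall_zero_iff, pi_norm_le_iff_of_nonneg (by norm_num)] at hc₀
    have h := hc₀ i
    rw [hm, Real.norm_eq_abs, ← Int.cast_abs] at h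
    have hm0 : |m| < 1 := by
      have : ((|m| : ℤ) : ℝ) < 1 := by linarith
      exact_mod_cast this
    rw [hm, Int.abs_lt_one_iff.1 hm0]
    simp
  rw [hc0, Matrix.mulVec_zero] at h1
  simp at h1
  linarith

/-! ### Bang's lemma and cubic symmetry -/

/-- **Bang's lemma**: suitable signs `ε` make `q = ∑ ε i c i x i` avoid all planks
`|⟨q, x i⟩ + k i| < c i |x i|²`. -/
theorem exists_signs_bang {ι : Type*} (s : Finset ι) {d : ℕ} (x : ι → Fin d → ℝ) (k c : ι → ℝ)
    (hc : ∀ i ∈ s, 0 < c i) :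
    ∃ ε : ι → ℝ, (∀ i, ε i = 1 ∨ ε i = -1) ∧ ∀ i ∈ s,
      c i * (x i ⬝ᵥ x i) ≤ ε i * ((∑ j ∈ s, (ε j * c j) • x j) ⬝ᵥ x i + k i) := by
  classical
  set q : (ι → ℝ) → Fin d → ℝ := fun ε => ∑ j ∈ s, (ε j * c j) • x j with hq
  set Φ : (ι → ℝ) → ℝ := fun ε => q ε ⬝ᵥ q ε + 2 * ∑ j ∈ s, ε j * c j * k j with hΦ
  set sgn : Finset ι → ι → ℝ := fun t i => if i ∈ t then 1 else -1 with hsgn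
  -- The signs maximise `|q|² + 2 ∑ ε c k`; each required inequality says that flipping one sign
  -- does not increase this quantity.
  obtain ⟨t, -, ht⟩ := Finset.exists_max_image s.powerset (fun t => Φ (sgn t))
    ⟨∅, Finset.empty_mem_powerset s⟩
  have hpm : ∀ i, sgn t i = 1 ∨ sgn t i = -1 := fun i => by
    by_cases h : i ∈ t <;> simp [hsgn, h]
  refine ⟨sgn t, hpm, fun i hi => ?_⟩
  set ε := sgn t
  set ε' := Function.update ε i (-ε i)
  -- Stated for a general module so as to cover both the vector sum `q` and the scalar sum.
  have hsum : ∀ (M : Type) [AddCommGroup M] [Module ℝ M] (f : ι → M),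
      ∑ j ∈ s, ε' j • f j = ∑ j ∈ s, ε j • f j - (2 * ε i) • f i := by
    intro M _ _ f
    rw [← Finset.add_sum_erase s _ hi, ← Finset.add_sum_erase s (fun j => ε j • f j) hi]
    have : ∑ j ∈ s.erase i, ε' j • f j = ∑ j ∈ s.erase i, ε j • f j :=
      Finset.sum_congr rfl fun j hj => by
        simp only [ε', Function.update_of_ne (Finset.ne_of_mem_erase hj)]
    rw [this]
    simp only [ε', Function.update_self]
    module
  have hq' : q ε' = q ε - (2 * ε i) • c i • x i := by
    simpa only [hq, mul_smul] using hsum _ (fun j => c j • x j)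
  have hk' : ∑ j ∈ s, ε' j * c j * k j = ∑ j ∈ s, ε j * c j * k j - 2 * ε i * (c i * k i) := by
    simpa only [smul_eq_mul, mul_assoc] using hsum ℝ (fun j => c j * k j)
  have hε' : ∃ t' ∈ s.powerset, Φ ε' = Φ (sgn t') := by
    refine ⟨s.filter fun j => ε' j = 1, by simp, ?_⟩
    have : ∀ j ∈ s, ε' j = sgn (s.filter fun j => ε' j = 1) j := by
      intro j hj
      have : ε' j = 1 ∨ ε' j = -1 := by
        by_cases hji : j = i
        · subst hji
          simp only [ε', Function.update_self]
          rcases hpm j with h | h <;> simp [ε, h]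
        · simpa only [ε', Function.update_of_ne hji] using hpm j
      rcases this with h | h
      · simp [hsgn, h, hj]
      · rw [h]
        simp only [hsgn, Finset.mem_filter, hj, h, true_and]
        norm_num
    simp only [hΦ, hq]
    rw [Finset.sum_congr rfl fun j hj => by rw [this j hj],
      Finset.sum_congr (g := fun j => sgn (s.filter fun j => ε' j = 1) j * c j * k j) rfl
        fun j hj => by rw [this j hj]]
  obtain ⟨t', ht', hε'⟩ := hε'
  have hmax := ht t' ht'
  rw [← hε'] at hmax
  have hsq : ε i * ε i = 1 := by rcases hpm i with h | h <;> simp [ε, h]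
  have hexp : Φ ε' = Φ ε - 4 * c i * (ε i * (q ε ⬝ᵥ x i + k i)) + 4 * c i ^ 2 * (x i ⬝ᵥ x i) := by
    simp only [hΦ]
    rw [hq', hk']
    simp only [sub_dotProduct, dotProduct_sub, smul_dotProduct, dotProduct_smul, smul_eq_mul]
    rw [dotProduct_comm (x i) (q ε)]
    linear_combination (4 * c i ^ 2 * (x i ⬝ᵥ x i)) * hsq
  have h1 : c i * (c i * (x i ⬝ᵥ x i)) ≤ c i * (ε i * (q ε ⬝ᵥ x i + k i)) := by
    change Φ ε' ≤ Φ ε at hmax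
    nlinarith
  exact le_of_mul_le_mul_left h1 (hc i hi)

/-- A weighted sum of `(q ⬝ z)²` invariant under the symmetries of the cube is isotropic. -/
theorem sum_mul_dotProduct_sq {d : ℕ} (S : Finset (Fin d → ℤ)) (w : (Fin d → ℤ) → ℝ)
    (hperm : ∀ (σ : Equiv.Perm (Fin d)), ∀ z ∈ S, z ∘ σ ∈ S ∧ w (z ∘ σ) = w z)
    (hflip : ∀ i, ∀ z ∈ S, Function.update z i (-z i) ∈ S ∧ w (Function.update z i (-z i)) = w z)
    (q : Fin d → ℝ) :
    d * ∑ z ∈ S, w z * (q ⬝ᵥ fun i => (z i : ℝ)) ^ 2 =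
      (q ⬝ᵥ q) * ∑ z ∈ S, w z * ((fun i => (z i : ℝ)) ⬝ᵥ fun i => (z i : ℝ)) := by
  set M : Fin d → Fin d → ℝ := fun i j => ∑ z ∈ S, w z * (z i * z j) with hM
  -- Changing the sign of coordinate `i` negates the off-diagonal second moments; swapping
  -- coordinates equates the diagonal ones. The moment matrix is therefore scalar.
  have hoff : ∀ i j, i ≠ j → M i j = 0 := by
    intro i j hij
    have : M i j = ∑ z ∈ S, -(w z * (z i * z j)) := by
      refine Finset.sum_nbij' (fun z => Function.update z i (-z i))
        (fun z => Function.update z i (-z i)) (fun z hz => (hflip i z hz).1)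
        (fun z hz => (hflip i z hz).1) (by simp) (by simp) fun z hz => ?_
      rw [(hflip i z hz).2, Function.update_self, Function.update_of_ne hij.symm]
      push_cast
      ring
    rw [Finset.sum_neg_distrib] at this
    simp only [hM] at this ⊢
    linarith
  have hdiag : ∀ i j, M i i = M j j := by
    intro i j
    refine Finset.sum_nbij' (fun z => z ∘ Equiv.swap i j) (fun z => z ∘ Equiv.swap i j)
      (fun z hz => (hperm _ z hz).1) (fun z hz => (hperm _ z hz).1) ?_ ?_ ?_
    · intro z _; ext k; simp
    · intro z _; ext k; simp
    · intro z hz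
      rw [(hperm _ z hz).2]
      simp
  have h1 : ∑ z ∈ S, w z * (q ⬝ᵥ fun i => (z i : ℝ)) ^ 2 = ∑ i, ∑ j, q i * q j * M i j := by
    have h : ∀ z : Fin d → ℤ, w z * (q ⬝ᵥ fun i => (z i : ℝ)) ^ 2 =
        ∑ i, ∑ j, q i * q j * (w z * (z i * z j)) := by
      intro z
      simp only [dotProduct]
      rw [sq, Finset.sum_mul_sum, Finset.mul_sum]
      refine Finset.sum_congr rfl fun i _ => ?_
      rw [Finset.mul_sum]
      exact Finset.sum_congr rfl fun j _ => by ring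
    simp only [h, hM, Finset.mul_sum]
    rw [Finset.sum_comm]
    refine Finset.sum_congr rfl fun i _ => ?_
    rw [Finset.sum_comm]
  have h2 : ∑ z ∈ S, w z * ((fun i => (z i : ℝ)) ⬝ᵥ fun i => (z i : ℝ)) = ∑ i, M i i := by
    simp only [hM, dotProduct, Finset.mul_sum]
    exact Finset.sum_comm
  have h3 : ∀ i, ∑ j, q i * q j * M i j = q i * q i * M i i := fun i =>
    Finset.sum_eq_single i (fun j _ hj => by rw [hoff i j hj.symm, mul_zero]) (by simp)
  rw [h1, h2, Finset.sum_congr rfl fun i _ => h3 i, dotProduct, Finset.sum_mul, Finset.mul_sum]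
  refine Finset.sum_congr rfl fun i _ => ?_
  rw [Finset.sum_congr rfl fun j _ => hdiag j i]
  simp
  ring

/-! ### Counting coprime integers and cancelling signs -/

/-- The density `∏ (1 - 1 / p)`, over primes `p ∣ g`, of the integers coprime to `g`. -/
noncomputable def coprimeDensity (g : ℕ) : ℝ :=
  ∑ e ∈ g.divisors, (ArithmeticFunction.moebius e : ℝ) / e

theorem card_Icc_filter_dvd (m e : ℕ) (he : 0 < e) :
    ((Finset.Icc (-(m : ℤ)) m).filter fun k => (e : ℤ) ∣ k).card = 2 * (m / e) + 1 := by
  have he' : (0 : ℤ) < e := by exact_mod_cast he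
  have h : (Finset.Icc (-(m : ℤ)) m).filter (fun k => (e : ℤ) ∣ k) =
      (Finset.Icc (-((m / e : ℕ) : ℤ)) (m / e : ℕ)).image fun j => (e : ℤ) * j := by
    ext k
    simp only [Finset.mem_filter, Finset.mem_Icc, Finset.mem_image]
    push_cast
    constructor
    · rintro ⟨⟨h1, h2⟩, j, rfl⟩
      refine ⟨j, ⟨?_, ?_⟩, rfl⟩
      · have : -j ≤ (m : ℤ) / e := (Int.le_ediv_iff_mul_le he').2 (by linarith)
        linarith
      · exact (Int.le_ediv_iff_mul_le he').2 (by linarith)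
    · rintro ⟨j, ⟨h1, h2⟩, rfl⟩
      have h3 : -j ≤ (m : ℤ) / e := by linarith
      rw [Int.le_ediv_iff_mul_le he'] at h2 h3
      exact ⟨⟨by linarith, by linarith⟩, dvd_mul_right _ _⟩
  rw [h, Finset.card_image_of_injective _ (mul_right_injective₀ he'.ne'), Int.card_Icc]
  omega

theorem sum_divisors_filter_dvd_moebius {g : ℕ} (hg : g ≠ 0) (k : ℤ) :
    ∑ e ∈ g.divisors, (if (e : ℤ) ∣ k then (ArithmeticFunction.moebius e : ℝ) else 0) =
      if k.natAbs.Coprime g then 1 else 0 := by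
  have h : g.divisors.filter (fun e : ℕ => (e : ℤ) ∣ k) = (k.natAbs.gcd g).divisors := by
    ext e
    simp [Nat.dvd_gcd_iff, hg, Int.natCast_dvd, and_comm]
  rw [← Finset.sum_filter, h, ← Int.cast_sum, ← ArithmeticFunction.coe_mul_zeta_apply,
    ArithmeticFunction.moebius_mul_coe_zeta, ArithmeticFunction.one_apply]
  simp [Nat.Coprime]

/-- Inclusion-exclusion over the divisors of `g`: each divisor contributes its main term with an
error of at most 1, whence the term `g.divisors.card`. -/
theorem card_le_of_coprime {g : ℕ} (hg : g ≠ 0) {Y : ℝ} (hY : 0 ≤ Y) (s : Finset ℤ)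
    (hs : ∀ k ∈ s, |(k : ℝ)| ≤ Y ∧ k.natAbs.Coprime g) :
    (s.card : ℝ) ≤ 2 * coprimeDensity g * Y + g.divisors.card := by
  set m := ⌊Y⌋₊
  have hsub : s ⊆ (Finset.Icc (-(m : ℤ)) m).filter fun k => k.natAbs.Coprime g := by
    intro k hk
    obtain ⟨h1, h2⟩ := hs k hk
    rw [Finset.mem_filter, Finset.mem_Icc, ← abs_le]
    refine ⟨?_, h2⟩
    rw [← Int.cast_abs, Int.abs_eq_natAbs, Int.cast_natCast] at h1
    rw [Int.abs_eq_natAbs]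
    exact_mod_cast Nat.le_floor h1
  have hcount : (((Finset.Icc (-(m : ℤ)) m).filter fun k => k.natAbs.Coprime g).card : ℝ) =
      ∑ e ∈ g.divisors, (ArithmeticFunction.moebius e : ℝ) * (2 * (m / e : ℕ) + 1) := by
    rw [Finset.card_filter, Nat.cast_sum]
    simp only [Nat.cast_ite, Nat.cast_one, Nat.cast_zero]
    rw [Finset.sum_congr rfl fun k _ => (sum_divisors_filter_dvd_moebius hg k).symm,
      Finset.sum_comm]
    refine Finset.sum_congr rfl fun e he => ?_
    rw [← Finset.sum_filter, Finset.sum_const, nsmul_eq_mul,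
      card_Icc_filter_dvd m e (Nat.pos_of_mem_divisors he)]
    push_cast
    ring
  calc (s.card : ℝ) ≤ _ := Nat.cast_le.2 (Finset.card_le_card hsub)
    _ = _ := hcount
    _ ≤ ∑ e ∈ g.divisors, (2 * ((ArithmeticFunction.moebius e : ℝ) / e) * Y + 1) := by
      refine Finset.sum_le_sum fun e he => ?_
      have he0 : (0 : ℝ) < e := Nat.cast_pos.2 (Nat.pos_of_mem_divisors he)
      have hmu : |(ArithmeticFunction.moebius e : ℝ)| ≤ 1 := by
        rw [← Int.cast_abs]
        exact_mod_cast ArithmeticFunction.abs_moebius_le_one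
      have hfl : (m / e : ℕ) = ⌊Y / e⌋₊ := (Nat.floor_div_natCast Y e).symm
      have h1 : ((m / e : ℕ) : ℝ) ≤ Y / e := by
        rw [hfl]; exact Nat.floor_le (by positivity)
      have h2 : Y / e < ((m / e : ℕ) : ℝ) + 1 := by
        rw [hfl]; exact Nat.lt_floor_add_one _
      set a : ℝ := ((m / e : ℕ) : ℝ)
      -- Here `a = ⌊Y / e⌋`, and `2 a + 1` counts the multiples of `e` in `[-Y, Y]`.
      have h3 : |2 * a + 1 - 2 * (Y / e)| ≤ 1 := by rw [abs_le]; constructor <;> linarith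
      have h4 : (ArithmeticFunction.moebius e : ℝ) * (2 * a + 1 - 2 * (Y / e)) ≤ 1 := by
        refine (le_abs_self _).trans ?_
        rw [abs_mul]
        exact mul_le_one₀ hmu (abs_nonneg _) h3
      have h5 : 2 * ((ArithmeticFunction.moebius e : ℝ) / e) * Y =
          (ArithmeticFunction.moebius e : ℝ) * (2 * (Y / e)) := by ring
      rw [h5]
      linarith
    _ = _ := by
      rw [Finset.sum_add_distrib, ← Finset.sum_mul, ← Finset.mul_sum, coprimeDensity]
      simp

/-- When `|k| > |y|`, the sign of `y + k` is that of `k`, so positivity forces opposite signs at `k`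
and `-k` and these terms cancel. At most `2 * coprimeDensity g * |y| + g.divisors.card` terms
remain, each at most `|y|`. The resulting bound does not depend on `K`. -/
theorem sum_signs_mul_le {g : ℕ} (hg : g ≠ 0) (K : ℕ) (y : ℝ) (ε : ℤ → ℝ)
    (hε : ∀ k, ε k = 1 ∨ ε k = -1)
    (hpos : ∀ k ∈ (Finset.Icc (-(K : ℤ)) K).filter (fun k => k.natAbs.Coprime g),
      0 < ε k * (y + k)) :
    ∑ k ∈ (Finset.Icc (-(K : ℤ)) K).filter (fun k => k.natAbs.Coprime g), ε k * y ≤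
      2 * coprimeDensity g * y ^ 2 + g.divisors.card * |y| := by
  classical
  set S := (Finset.Icc (-(K : ℤ)) K).filter (fun k => k.natAbs.Coprime g) with hS
  have hSneg : ∀ k ∈ S, -k ∈ S := by
    intro k hk
    simp only [hS, Finset.mem_filter, Finset.mem_Icc, Int.natAbs_neg] at hk ⊢
    exact ⟨⟨by linarith, by linarith⟩, hk.2⟩
  rw [← Finset.sum_filter_add_sum_filter_not S (fun k : ℤ => |(k : ℝ)| ≤ |y|)]
  have hodd : ∀ k ∈ S.filter (fun k : ℤ => ¬ |(k : ℝ)| ≤ |y|), ε (-k) = -ε k := by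
    have key : ∀ k ∈ S, |y| < (k : ℝ) → ε k = 1 ∧ ε (-k) = -1 := by
      intro k hk hky
      have h1 := hpos k hk
      have h2 := hpos (-k) (hSneg k hk)
      have h3 := neg_abs_le y
      have h4 := le_abs_self y
      push_cast at h2
      constructor
      · rcases hε k with h | h
        · exact h
        · rw [h] at h1; linarith
      · rcases hε (-k) with h | h
        · rw [h] at h2; linarith
        · exact h
    intro k hk
    rw [Finset.mem_filter, not_le, lt_abs] at hk
    rcases hk with ⟨hk, h | h⟩
    · rw [(key k hk h).1, (key k hk h).2]
    · have := key (-k) (hSneg k hk) (by push_cast; exact h)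
      rw [neg_neg] at this
      rw [this.1, this.2, neg_neg]
  have h0 : ∑ k ∈ S.filter (fun k : ℤ => ¬ |(k : ℝ)| ≤ |y|), ε k * y = 0 := by
    have : ∑ k ∈ S.filter (fun k : ℤ => ¬ |(k : ℝ)| ≤ |y|), ε k * y =
        ∑ k ∈ S.filter (fun k : ℤ => ¬ |(k : ℝ)| ≤ |y|), -(ε k * y) := by
      have hmem : ∀ k ∈ S.filter (fun k : ℤ => ¬ |(k : ℝ)| ≤ |y|),
          -k ∈ S.filter (fun k : ℤ => ¬ |(k : ℝ)| ≤ |y|) := by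
        intro k hk
        rw [Finset.mem_filter] at hk ⊢
        exact ⟨hSneg k hk.1, by simpa using hk.2⟩
      refine Finset.sum_nbij' (fun k => -k) (fun k => -k) hmem hmem (by simp) (by simp) ?_
      intro k hk
      rw [hodd k hk]
      ring
    rw [Finset.sum_neg_distrib] at this
    linarith
  rw [h0, add_zero]
  have hcard := card_le_of_coprime hg (abs_nonneg y) (S.filter (fun k : ℤ => |(k : ℝ)| ≤ |y|))
    (fun k hk => by
      rw [Finset.mem_filter, hS, Finset.mem_filter] at hk
      exact ⟨hk.2, hk.1.2⟩)
  calc ∑ k ∈ S.filter (fun k : ℤ => |(k : ℝ)| ≤ |y|), ε k * y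
      ≤ ∑ k ∈ S.filter (fun k : ℤ => |(k : ℝ)| ≤ |y|), |y| := by
        refine Finset.sum_le_sum fun k _ => ?_
        rcases hε k with h | h
        · rw [h, one_mul]; exact le_abs_self y
        · rw [h, neg_one_mul]; exact neg_le_abs y
    _ = (S.filter (fun k : ℤ => |(k : ℝ)| ≤ |y|)).card * |y| := by
        rw [Finset.sum_const, nsmul_eq_mul]
    _ ≤ (2 * coprimeDensity g * |y| + g.divisors.card) * |y| :=
        mul_le_mul_of_nonneg_right hcard (abs_nonneg y)
    _ = _ := by
        rw [← sq_abs y]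
        ring

/-! ### Greatest common divisors of integer vectors -/

/-- The greatest common divisor of the coordinates of an integer vector. -/
def gcdVec {d : ℕ} (z : Fin d → ℤ) : ℕ := Finset.univ.gcd fun i => (z i).natAbs

theorem dvd_gcdVec_iff {d : ℕ} {z : Fin d → ℤ} {e : ℕ} : e ∣ gcdVec z ↔ ∀ i, (e : ℤ) ∣ z i := by
  simp [gcdVec, Finset.dvd_gcd_iff, Int.natCast_dvd]

theorem gcdVec_comp_perm {d : ℕ} (σ : Equiv.Perm (Fin d)) (z : Fin d → ℤ) :
    gcdVec (z ∘ σ) = gcdVec z := by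
  refine Nat.dvd_left_iff_eq.1 fun e => ?_
  rw [dvd_gcdVec_iff, dvd_gcdVec_iff]
  exact σ.forall_congr_left.trans (by simp)

theorem gcdVec_update_neg {d : ℕ} (i : Fin d) (z : Fin d → ℤ) :
    gcdVec (Function.update z i (-z i)) = gcdVec z := by
  unfold gcdVec
  congr 1
  ext j
  by_cases h : j = i
  · subst h; simp
  · rw [Function.update_of_ne h]

theorem gcdVec_neg {d : ℕ} (z : Fin d → ℤ) : gcdVec (-z) = gcdVec z := by
  simp [gcdVec]

theorem gcdVec_ne_zero {d : ℕ} {z : Fin d → ℤ} (hz : z ≠ 0) : gcdVec z ≠ 0 := by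
  intro h
  apply hz
  ext i
  have := (dvd_gcdVec_iff (z := z) (e := 0)).1 (by rw [h]) i
  simpa using this

theorem abs_dotProduct_le_sqrt_mul_sqrt {d : ℕ} (q x : Fin d → ℝ) :
    |q ⬝ᵥ x| ≤ √(q ⬝ᵥ q) * √(x ⬝ᵥ x) := by
  have h : (q ⬝ᵥ x) ^ 2 ≤ (q ⬝ᵥ q) * (x ⬝ᵥ x) := by
    simpa only [dotProduct, ← sq] using Finset.sum_mul_sq_le_sq_mul_sq Finset.univ q x
  have hq : 0 ≤ q ⬝ᵥ q := Finset.sum_nonneg fun i _ => mul_self_nonneg _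
  rw [← Real.sqrt_mul hq]
  exact Real.abs_le_sqrt h

-- The lexicographic sign selects one vector from each pair `z`, `-z`. Since `(z, k)` and `(-z, -k)`
-- define the same plank, Bang's lemma is applied to one half only, which saves a factor of 2.
open Classical in
theorem sum_eq_two_mul_sum_pos {d : ℕ} (P : Finset (Fin d → ℤ)) (h0 : 0 ∉ P)
    (hneg : ∀ z ∈ P, -z ∈ P) (f : (Fin d → ℤ) → ℝ) (hf : ∀ z ∈ P, f (-z) = f z) :
    ∑ z ∈ P, f z = 2 * ∑ z ∈ P.filter (fun z => 0 < toLex z), f z := by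
  rw [← Finset.sum_filter_add_sum_filter_not P (fun z => 0 < toLex z), two_mul]
  congr 1
  refine Finset.sum_nbij' (fun z => -z) (fun z => -z) ?_ ?_ (by simp) (by simp) ?_
  · intro z hz
    rw [Finset.mem_filter] at hz ⊢
    refine ⟨hneg z hz.1, ?_⟩
    have h1 : toLex z ≠ 0 := fun h => h0 (by rw [show (0 : Fin d → ℤ) = z from h.symm]; exact hz.1)
    have h2 : toLex z < 0 := lt_of_le_of_ne (not_lt.1 hz.2) h1
    rw [toLex_neg]
    exact neg_pos.2 h2
  · intro z hz
    rw [Finset.mem_filter] at hz ⊢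
    refine ⟨hneg z hz.1, ?_⟩
    rw [toLex_neg, neg_pos]
    exact not_lt.2 hz.2.le
  · intro z hz
    exact (hf z (Finset.mem_filter.1 hz).1).symm

/-! ### Avoiding infinitely many planks -/

/-- A point `q` avoiding all the planks `|⟨q, z⟩ + k| < η z` with `(z, k)` primitive and `z` in a
finite set of integer vectors with the symmetries of the cube. -/
theorem exists_forall_le_abs_dotProduct_add {d : ℕ} (hd : 0 < d) (P : Finset (Fin d → ℤ))
    (h0 : 0 ∉ P) (η : (Fin d → ℤ) → ℝ) (hη : ∀ z ∈ P, 0 < η z ∧ η z ≤ 1)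
    (hneg : ∀ z ∈ P, -z ∈ P ∧ η (-z) = η z)
    (hperm : ∀ (σ : Equiv.Perm (Fin d)), ∀ z ∈ P, z ∘ σ ∈ P ∧ η (z ∘ σ) = η z)
    (hflip : ∀ i, ∀ z ∈ P, Function.update z i (-z i) ∈ P ∧ η (Function.update z i (-z i)) = η z)
    (hsum : ∑ z ∈ P, η z * coprimeDensity (gcdVec z) < d) :
    ∃ q : Fin d → ℝ, ∀ z ∈ P, ∀ k : ℤ, k.natAbs.Coprime (gcdVec z) →
      η z ≤ |(q ⬝ᵥ fun i => (z i : ℝ)) + k| := by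
  classical
  have hdR : (0 : ℝ) < d := Nat.cast_pos.2 hd
  set x : (Fin d → ℤ) → Fin d → ℝ := fun z i => (z i : ℝ) with hx
  have hxpos : ∀ z ∈ P, 0 < x z ⬝ᵥ x z := by
    intro z hz
    refine lt_of_le_of_ne (Finset.sum_nonneg fun i _ => mul_self_nonneg _) (fun h => h0 ?_)
    have h1 := dotProduct_self_eq_zero.1 h.symm
    have : z = 0 := by
      ext i
      simpa [hx] using congrFun h1 i
    rwa [← this]
  have hxneg : ∀ z, x (-z) = -x z := fun z => by ext i; simp [hx]
  have hxperm : ∀ (σ : Equiv.Perm (Fin d)) z, x (z ∘ σ) ⬝ᵥ x (z ∘ σ) = x z ⬝ᵥ x z := fun σ z => by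
    simp only [hx, dotProduct, Function.comp]
    exact Equiv.sum_comp σ fun i => (z i : ℝ) * z i
  have hxflip : ∀ i z, x (Function.update z i (-z i)) ⬝ᵥ x (Function.update z i (-z i)) =
      x z ⬝ᵥ x z := fun i z => by
    simp only [hx, dotProduct]
    refine Finset.sum_congr rfl fun j _ => ?_
    by_cases h : j = i
    · subst h; simp
    · rw [Function.update_of_ne h]
  -- With this weight, the width `c |x|²` in Bang's lemma is exactly `η z`.
  set c : (Fin d → ℤ) → ℝ := fun z => η z / (x z ⬝ᵥ x z) with hc
  have hcpos : ∀ z ∈ P, 0 < c z := fun z hz => div_pos (hη z hz).1 (hxpos z hz)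
  set H := P.filter (fun z => 0 < toLex z) with hH
  have hHP : ∀ z ∈ H, z ∈ P := fun z hz => (Finset.mem_filter.1 hz).1
  set κ := (∑ z ∈ P, η z * coprimeDensity (gcdVec z)) / d with hκ
  have hκ1 : κ < 1 := (div_lt_one hdR).2 hsum
  set C := ∑ z ∈ H, c z * ((gcdVec z).divisors.card * √(x z ⬝ᵥ x z))
  set R := ∑ z ∈ P, √(x z ⬝ᵥ x z)
  have hC : 0 ≤ C := Finset.sum_nonneg fun z hz =>
    mul_nonneg (hcpos z (hHP z hz)).le (by positivity)
  -- `C / (1 - κ)` will bound `|q|` for every cutoff, and `R` bounds each `|z|`. Hence `K` exceeds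
  -- every `|⟨q, z⟩|` by at least 1, and planks with `|k| > K` are avoided automatically because `η
  -- z ≤ 1`.
  obtain ⟨K, hK⟩ := exists_nat_ge (C / (1 - κ) * R + 1)
  set s := (H ×ˢ Finset.Icc (-(K : ℤ)) K).filter fun p => p.2.natAbs.Coprime (gcdVec p.1) with hs
  have hsH : ∀ p ∈ s, p.1 ∈ H := fun p hp => by
    rw [hs, Finset.mem_filter, Finset.mem_product] at hp
    exact hp.1.1
  obtain ⟨ε, hε, hbang⟩ := exists_signs_bang s (fun p => x p.1) (fun p => (p.2 : ℝ))
    (fun p => c p.1) (fun p hp => hcpos _ (hHP _ (hsH p hp)))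
  set q := ∑ p ∈ s, (ε p * c p.1) • x p.1 with hq
  have hbang' : ∀ p ∈ s, η p.1 ≤ ε p * (q ⬝ᵥ x p.1 + p.2) := by
    intro p hp
    have h := hbang p hp
    simp only [hc] at h
    rwa [div_mul_cancel₀ _ (hxpos _ (hHP _ (hsH p hp))).ne'] at h
  have hQ0 : 0 ≤ q ⬝ᵥ q := Finset.sum_nonneg fun i _ => mul_self_nonneg _
  have hQ1 : q ⬝ᵥ q = ∑ z ∈ H, c z * ∑ k ∈ (Finset.Icc (-(K : ℤ)) K).filter
      (fun k => k.natAbs.Coprime (gcdVec z)), ε (z, k) * (q ⬝ᵥ x z) := by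
    have : q ⬝ᵥ q = ∑ p ∈ s, ε p * c p.1 * (q ⬝ᵥ x p.1) := by
      conv_lhs => enter [2]; rw [hq]
      rw [dotProduct_sum]
      exact Finset.sum_congr rfl fun p _ => by rw [dotProduct_smul, smul_eq_mul]
    rw [this, hs, Finset.sum_filter, Finset.sum_product]
    refine Finset.sum_congr rfl fun z _ => ?_
    rw [← Finset.sum_filter, Finset.mul_sum]
    exact Finset.sum_congr rfl fun k _ => by ring
  have hQ2 : q ⬝ᵥ q ≤ ∑ z ∈ H, c z * (2 * coprimeDensity (gcdVec z) * (q ⬝ᵥ x z) ^ 2 +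
      (gcdVec z).divisors.card * |q ⬝ᵥ x z|) := by
    rw [hQ1]
    refine Finset.sum_le_sum fun z hz => mul_le_mul_of_nonneg_left ?_ (hcpos z (hHP z hz)).le
    refine sum_signs_mul_le (gcdVec_ne_zero fun h => h0 (h ▸ hHP z hz)) K _ (fun k => ε (z, k))
      (fun k => hε _) fun k hk => ?_
    rw [Finset.mem_filter] at hk
    exact (hη z (hHP z hz)).1.trans_le
      (hbang' (z, k) (Finset.mem_filter.2 ⟨Finset.mem_product.2 ⟨hz, hk.1⟩, hk.2⟩))
  -- By isotropy the quadratic part equals `κ |q|²`: the factor `|z|²` cancels the denominator of `c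
  -- z`, and the 2 turns the half-sum into the full sum.
  have hmain : ∑ z ∈ H, c z * (2 * coprimeDensity (gcdVec z) * (q ⬝ᵥ x z) ^ 2) = κ * (q ⬝ᵥ q) := by
    have h1 := sum_eq_two_mul_sum_pos P h0 (fun z hz => (hneg z hz).1)
      (fun z => c z * coprimeDensity (gcdVec z) * (q ⬝ᵥ x z) ^ 2) (fun z hz => by
        simp only [hc, gcdVec_neg, hxneg, (hneg z hz).2, dotProduct_neg, neg_dotProduct, neg_neg,
          neg_sq])
    have h2 := sum_mul_dotProduct_sq P (fun z => c z * coprimeDensity (gcdVec z))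
      (fun σ z hz => ⟨(hperm σ z hz).1, by
        simp only [hc, gcdVec_comp_perm, (hperm σ z hz).2, hxperm]⟩)
      (fun i z hz => ⟨(hflip i z hz).1, by
        simp only [hc, gcdVec_update_neg, (hflip i z hz).2, hxflip]⟩) q
    have h3 : ∑ z ∈ P, c z * coprimeDensity (gcdVec z) * (x z ⬝ᵥ x z) =
        ∑ z ∈ P, η z * coprimeDensity (gcdVec z) := by
      refine Finset.sum_congr rfl fun z hz => ?_
      simp only [hc]
      field_simp [(hxpos z hz).ne']
    change (d : ℝ) * ∑ z ∈ P, c z * coprimeDensity (gcdVec z) * (q ⬝ᵥ x z) ^ 2 =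
      (q ⬝ᵥ q) * ∑ z ∈ P, c z * coprimeDensity (gcdVec z) * (x z ⬝ᵥ x z) at h2
    rw [h3, h1] at h2
    have h4 : ∑ z ∈ H, c z * (2 * coprimeDensity (gcdVec z) * (q ⬝ᵥ x z) ^ 2) =
        2 * ∑ z ∈ H, c z * coprimeDensity (gcdVec z) * (q ⬝ᵥ x z) ^ 2 := by
      rw [Finset.mul_sum]
      exact Finset.sum_congr rfl fun z _ => by ring
    rw [h4, hκ, div_mul_eq_mul_div, eq_div_iff hdR.ne', mul_comm _ (q ⬝ᵥ q), ← h2, mul_comm]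
  have hQ3 : q ⬝ᵥ q ≤ κ * (q ⬝ᵥ q) + C * √(q ⬝ᵥ q) := by
    refine hQ2.trans ?_
    simp only [mul_add, Finset.sum_add_distrib]
    rw [hmain]
    refine add_le_add le_rfl ?_
    rw [Finset.sum_mul]
    refine Finset.sum_le_sum fun z hz => ?_
    rw [mul_assoc, mul_assoc]
    refine mul_le_mul_of_nonneg_left (mul_le_mul_of_nonneg_left ?_ (Nat.cast_nonneg _))
      (hcpos z (hHP z hz)).le
    rw [mul_comm]
    exact abs_dotProduct_le_sqrt_mul_sqrt q (x z)
  -- From `|q|² ≤ κ |q|² + C |q|` with `κ < 1`; this is where the hypothesis `hsum` enters.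
  have hQ4 : √(q ⬝ᵥ q) ≤ C / (1 - κ) := by
    rw [le_div_iff₀ (by linarith)]
    rcases (Real.sqrt_nonneg (q ⬝ᵥ q)).eq_or_lt with h | h
    · rw [← h, zero_mul]; exact hC
    · have h1 := Real.mul_self_sqrt hQ0
      refine le_of_mul_le_mul_right ?_ h
      nlinarith
  have hhalf : ∀ z ∈ H, ∀ k : ℤ, k.natAbs.Coprime (gcdVec z) → η z ≤ |q ⬝ᵥ x z + k| := by
    intro z hz k hk
    by_cases hkK : k ∈ Finset.Icc (-(K : ℤ)) K
    · refine (hbang' (z, k)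
        (Finset.mem_filter.2 ⟨Finset.mem_product.2 ⟨hz, hkK⟩, hk⟩)).trans ?_
      rcases hε (z, k) with h | h
      · rw [h, one_mul]; exact le_abs_self _
      · rw [h, neg_one_mul]; exact neg_le_abs _
    · refine (hη z (hHP z hz)).2.trans ?_
      rw [Finset.mem_Icc, ← abs_le, not_le] at hkK
      have h1 : (K : ℝ) < |(k : ℝ)| := by
        rw [← Int.cast_abs]
        exact_mod_cast hkK
      have h2 : |q ⬝ᵥ x z| ≤ C / (1 - κ) * R := by
        refine (abs_dotProduct_le_sqrt_mul_sqrt q (x z)).trans ?_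
        refine mul_le_mul hQ4 ?_ (Real.sqrt_nonneg _) (div_nonneg hC (by linarith))
        exact Finset.single_le_sum (f := fun z => √(x z ⬝ᵥ x z))
          (fun z _ => Real.sqrt_nonneg _) (hHP z hz)
      have h3 := abs_sub_abs_le_abs_sub (k : ℝ) (-(q ⬝ᵥ x z))
      rw [abs_neg, sub_neg_eq_add, add_comm (k : ℝ)] at h3
      linarith
  refine ⟨q, fun z hz k hk => ?_⟩
  by_cases hzH : 0 < toLex z
  · exact hhalf z (Finset.mem_filter.2 ⟨hz, hzH⟩) k hk
  · have h1 : toLex z ≠ 0 := fun h => h0 (by rw [show (0 : Fin d → ℤ) = z from h.symm]; exact hz)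
    have h2 : toLex z < 0 := lt_of_le_of_ne (not_lt.1 hzH) h1
    have h3 := hhalf (-z) (Finset.mem_filter.2 ⟨(hneg z hz).1, by
      rw [toLex_neg]; exact neg_pos.2 h2⟩) (-k) (by rwa [Int.natAbs_neg, gcdVec_neg])
    rw [(hneg z hz).2, hxneg, dotProduct_neg, Int.cast_neg, ← neg_add, abs_neg] at h3
    exact h3

/-! ### Cap heights and their Riemann sums -/

/-- The height `√(1 - |x|²)` of the unit half-ball over `x`, zero outside the unit ball. -/
noncomputable def capHeight {d : ℕ} (x : Fin d → ℝ) : ℝ := √(1 - x ⬝ᵥ x)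

theorem continuous_capHeight {d : ℕ} : Continuous (capHeight (d := d)) := by
  unfold capHeight dotProduct
  fun_prop

theorem capHeight_le_one {d : ℕ} (x : Fin d → ℝ) : capHeight x ≤ 1 := by
  rw [capHeight, Real.sqrt_le_left zero_le_one, one_pow]
  linarith [show 0 ≤ x ⬝ᵥ x from Finset.sum_nonneg fun i _ => mul_self_nonneg _]

theorem capHeight_nonneg {d : ℕ} (x : Fin d → ℝ) : 0 ≤ capHeight x := Real.sqrt_nonneg _

theorem capHeight_eq_zero {d : ℕ} {x : Fin d → ℝ} (hx : 1 ≤ x ⬝ᵥ x) : capHeight x = 0 :=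
  Real.sqrt_eq_zero_of_nonpos (by linarith)

theorem capHeight_zero {d : ℕ} : capHeight (0 : Fin d → ℝ) = 1 := by simp [capHeight]

theorem abs_apply_lt_one_of_dotProduct_lt_one {d : ℕ} {x : Fin d → ℝ} (hx : x ⬝ᵥ x < 1)
    (i : Fin d) : |x i| < 1 := by
  have : x i * x i ≤ x ⬝ᵥ x :=
    Finset.single_le_sum (f := fun i => x i * x i) (fun i _ => mul_self_nonneg _)
      (Finset.mem_univ i)
  rw [← sq_lt_one_iff_abs_lt_one, sq]
  linarith

/-- The point of `N⁻¹ ℤᵈ` with numerators `z`. -/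
noncomputable def scaledVec {d : ℕ} (N : ℕ) (z : Fin d → ℤ) : Fin d → ℝ := fun i => (z i : ℝ) / N

theorem scaledVec_zero {d : ℕ} (N : ℕ) : scaledVec N (0 : Fin d → ℤ) = 0 := by
  ext i
  simp [scaledVec]

open Classical in
/-- The nonzero integer vectors `z` with `|z| < N`. -/
noncomputable def puncturedBall (d N : ℕ) : Finset (Fin d → ℤ) :=
  (Fintype.piFinset fun _ => Finset.Icc (-(N : ℤ)) N).filter
    fun z => z ≠ 0 ∧ scaledVec N z ⬝ᵥ scaledVec N z < 1

theorem mem_puncturedBall {d N : ℕ} (hN : 0 < N) {z : Fin d → ℤ} :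
    z ∈ puncturedBall d N ↔ z ≠ 0 ∧ scaledVec N z ⬝ᵥ scaledVec N z < 1 := by
  rw [puncturedBall, Finset.mem_filter, and_iff_right_iff_imp]
  rintro ⟨-, h⟩
  rw [Fintype.mem_piFinset]
  intro i
  have h1 := abs_apply_lt_one_of_dotProduct_lt_one h i
  have hN' : (0 : ℝ) < N := Nat.cast_pos.2 hN
  rw [scaledVec, abs_div, Nat.abs_cast, div_lt_one hN', ← Int.cast_abs] at h1
  rw [Finset.mem_Icc, ← abs_le]
  exact_mod_cast h1.le

theorem abs_apply_le_of_mem_puncturedBall {d N : ℕ} {z : Fin d → ℤ} (hz : z ∈ puncturedBall d N)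
    (i : Fin d) : |z i| ≤ N := by
  rw [puncturedBall, Finset.mem_filter, Fintype.mem_piFinset] at hz
  exact abs_le.2 (Finset.mem_Icc.1 (hz.1 i))

theorem ne_zero_of_mem_puncturedBall {d N : ℕ} {z : Fin d → ℤ} (hz : z ∈ puncturedBall d N) :
    z ≠ 0 := (Finset.mem_filter.1 hz).2.1

theorem le_of_dvd_gcdVec {d N e : ℕ} {z : Fin d → ℤ} (hz : z ∈ puncturedBall d N)
    (he : e ∣ gcdVec z) : e ≤ N := by
  obtain ⟨i, hi⟩ := Function.ne_iff.1 (ne_zero_of_mem_puncturedBall hz)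
  have h1 := Int.le_of_dvd (abs_pos.2 hi) ((dvd_abs _ _).2 (dvd_gcdVec_iff.1 he i))
  exact_mod_cast h1.trans (abs_apply_le_of_mem_puncturedBall hz i)

/-- The sum of the cap heights over the multiples of `e` in the punctured ball. -/
noncomputable def capSum (d N e : ℕ) : ℝ :=
  ∑ z ∈ (puncturedBall d N).filter (fun z => e ∣ gcdVec z), capHeight (scaledVec N z)

theorem capSum_nonneg (d N e : ℕ) : 0 ≤ capSum d N e :=
  Finset.sum_nonneg fun _ _ => capHeight_nonneg _

theorem capSum_eq_zero {d N e : ℕ} (h : N < e) : capSum d N e = 0 := by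
  rw [capSum, Finset.filter_false_of_mem, Finset.sum_empty]
  exact fun z hz he => absurd (le_of_dvd_gcdVec hz he) (by omega)

/-- A bound uniform in `N`, to serve as the dominating function in `tendsto_sum_capHeight_div`. For
`e ≤ N` each coordinate has `2 ⌊N / e⌋ + 1 ≤ 3 N / e` choices; for `e > N` the sum is empty because
the origin is excluded. -/
theorem capSum_div_le {d N e : ℕ} (hN : 0 < N) (he : 0 < e) :
    capSum d N e / N ^ d ≤ 3 ^ d / e ^ d := by
  rcases lt_or_ge N e with h | h
  · rw [capSum_eq_zero h, zero_div]
    positivity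
  have hN' : (0 : ℝ) < N := Nat.cast_pos.2 hN
  have he' : (0 : ℝ) < e := Nat.cast_pos.2 he
  have hsub : (puncturedBall d N).filter (fun z => e ∣ gcdVec z) ⊆
      Fintype.piFinset fun _ => (Finset.Icc (-(N : ℤ)) N).filter fun k => (e : ℤ) ∣ k := by
    intro z hz
    rw [Finset.mem_filter] at hz
    rw [Fintype.mem_piFinset]
    intro i
    rw [Finset.mem_filter, Finset.mem_Icc, ← abs_le]
    exact ⟨abs_apply_le_of_mem_puncturedBall hz.1 i, dvd_gcdVec_iff.1 hz.2 i⟩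
  have h1 : capSum d N e ≤ ((2 * (N / e : ℕ) + 1 : ℕ) : ℝ) ^ d := by
    calc capSum d N e ≤ ∑ z ∈ (puncturedBall d N).filter (fun z => e ∣ gcdVec z), (1 : ℝ) :=
          Finset.sum_le_sum fun _ _ => capHeight_le_one _
      _ = (((puncturedBall d N).filter (fun z => e ∣ gcdVec z)).card : ℝ) := by simp
      _ ≤ _ := by
        have h2 := Finset.card_le_card hsub
        rw [Fintype.card_piFinset, Finset.prod_const, Finset.card_univ, Fintype.card_fin,
          card_Icc_filter_dvd N e he] at h2
        exact_mod_cast h2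
  have h2 : ((2 * (N / e : ℕ) + 1 : ℕ) : ℝ) ≤ 3 * (N / e) := by
    have h3 : ((N / e : ℕ) : ℝ) ≤ N / e := Nat.cast_div_le
    have h4 : (1 : ℝ) ≤ N / e := (one_le_div he').2 (Nat.cast_le.2 h)
    push_cast
    linarith
  rw [div_le_iff₀ (by positivity)]
  refine (h1.trans (pow_le_pow_left₀ (Nat.cast_nonneg _) h2 d)).trans_eq ?_
  rw [mul_pow, div_pow]
  ring

/-- Expanding `coprimeDensity` over divisors and exchanging the sums; the series has finite support
for each `N`. -/
theorem sum_capHeight_mul_coprimeDensity (d N : ℕ) :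
    ∑ z ∈ puncturedBall d N, capHeight (scaledVec N z) * coprimeDensity (gcdVec z) =
      ∑' e : ℕ, (ArithmeticFunction.moebius e : ℝ) / e * capSum d N e := by
  rw [tsum_eq_sum (s := Finset.range (N + 1)) fun e he => by
    rw [Finset.mem_range, not_lt] at he
    rw [capSum_eq_zero (by omega), mul_zero]]
  simp only [capSum, Finset.sum_filter, Finset.mul_sum]
  rw [Finset.sum_comm]
  refine Finset.sum_congr rfl fun z hz => ?_
  have hg := gcdVec_ne_zero (ne_zero_of_mem_puncturedBall hz)
  rw [coprimeDensity, Finset.mul_sum]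
  have : (gcdVec z).divisors = (Finset.range (N + 1)).filter fun e => e ∣ gcdVec z := by
    ext e
    rw [Nat.mem_divisors, Finset.mem_filter, Finset.mem_range]
    exact ⟨fun h => ⟨Nat.lt_succ_of_le (le_of_dvd_gcdVec hz h.1), h.1⟩, fun h => ⟨h.2, hg⟩⟩
  rw [this, Finset.sum_filter]
  refine Finset.sum_congr rfl fun e _ => ?_
  split_ifs <;> ring

/-- Vectors divisible by `e` are written as `e • y`; the extra 1 is the height at the origin. -/
theorem tsum_capHeight_eq {d N e : ℕ} (hN : 0 < N) (he : 0 < e) :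
    ∑' y : Fin d → ℤ, capHeight ((e : ℝ) • scaledVec N y) = capSum d N e + 1 := by
  classical
  set f : (Fin d → ℤ) → ℝ := fun z => if e ∣ gcdVec z then capHeight (scaledVec N z) else 0
  have hinj : Function.Injective fun y : Fin d → ℤ => (e : ℤ) • y :=
    smul_right_injective _ (by exact_mod_cast he.ne')
  have h1 : ∀ y, capHeight ((e : ℝ) • scaledVec N y) = f ((e : ℤ) • y) := by
    intro y
    have : e ∣ gcdVec ((e : ℤ) • y) := dvd_gcdVec_iff.2 fun i => by simp
    simp only [f, if_pos this]
    congr 1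
    ext i
    simp [scaledVec, mul_div_assoc]
  simp only [h1]
  rw [hinj.tsum_eq (f := f)]
  · rw [tsum_eq_sum (s := insert 0 (puncturedBall d N)), Finset.sum_insert]
    · have h0 : f 0 = 1 := by
        have : e ∣ gcdVec (0 : Fin d → ℤ) := dvd_gcdVec_iff.2 fun i => by simp
        simp only [f, if_pos this, scaledVec_zero, capHeight_zero]
      rw [h0, capSum, Finset.sum_filter, add_comm]
    · exact fun h => ne_zero_of_mem_puncturedBall h rfl
    · intro z hz
      rw [Finset.mem_insert, not_or, mem_puncturedBall hN, not_and, not_lt] at hz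
      simp only [f, capHeight_eq_zero (hz.2 hz.1), ite_self]
  · intro z hz
    have h : e ∣ gcdVec z := by
      by_contra h
      simp [f, h] at hz
    choose y hy using dvd_gcdVec_iff.1 h
    exact ⟨y, by ext i; simp [hy i]⟩

open scoped Pointwise in
theorem tendsto_tsum_div_pow {d : ℕ} (F : (Fin d → ℝ) → ℝ) (hF : Continuous F)
    (hF0 : ∀ x, 1 < ‖x‖ → F x = 0) :
    Tendsto (fun N : ℕ => (∑' y : Fin d → ℤ, F (scaledVec N y)) / N ^ d) atTop (𝓝 (∫ x, F x)) := by
  have h := tendsto_tsum_div_pow_atTop_integral (Metric.closedBall (0 : Fin d → ℝ) 1) F hF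
    Metric.isBounded_closedBall measurableSet_closedBall
    ((convex_closedBall _ _).addHaar_frontier _)
  have h0 : ∀ x ∉ Metric.closedBall (0 : Fin d → ℝ) 1, F x = 0 := fun x hx => hF0 x (by simpa using hx)
  rw [setIntegral_eq_integral_of_forall_compl_eq_zero h0, Fintype.card_fin] at h
  refine h.congr' ?_
  filter_upwards [eventually_gt_atTop 0] with N hN
  have hN' : (N : ℝ) ≠ 0 := Nat.cast_ne_zero.2 hN.ne'
  congr 1
  have hinj : Function.Injective (scaledVec N : (Fin d → ℤ) → Fin d → ℝ) := by
    intro y y' hy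
    ext i
    have := congrFun hy i
    simp only [scaledVec] at this
    rw [div_left_inj' hN'] at this
    exact_mod_cast this
  set A := Metric.closedBall (0 : Fin d → ℝ) 1 ∩
    (N : ℝ)⁻¹ • (Submodule.span ℤ (Set.range (Pi.basisFun ℝ (Fin d))) : Set (Fin d → ℝ))
  have hrange : ∀ x, x ∈ (N : ℝ)⁻¹ • (Submodule.span ℤ (Set.range (Pi.basisFun ℝ (Fin d))) :
      Set (Fin d → ℝ)) ↔ x ∈ Set.range (scaledVec N : (Fin d → ℤ) → Fin d → ℝ) := by
    intro x
    rw [Set.mem_inv_smul_set_iff₀ hN', SetLike.mem_coe, Module.Basis.mem_span_iff_repr_mem]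
    constructor
    · intro hx
      choose y hy using hx
      refine ⟨y, ?_⟩
      ext i
      have := hy i
      simp only [algebraMap_int_eq, Int.coe_castRingHom, Pi.basisFun_repr, Pi.smul_apply,
        smul_eq_mul] at this
      rw [scaledVec, this]
      field_simp
    · rintro ⟨y, rfl⟩ i
      refine ⟨y i, ?_⟩
      simp only [algebraMap_int_eq, Int.coe_castRingHom, Pi.basisFun_repr, Pi.smul_apply,
        smul_eq_mul, scaledVec]
      field_simp
  rw [tsum_subtype A F, ← hinj.tsum_eq (f := A.indicator F)]
  · refine tsum_congr fun y => ?_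
    by_cases hy : scaledVec N y ∈ A
    · rw [Set.indicator_of_mem hy]
    · rw [Set.indicator_of_notMem hy, h0]
      exact fun h => hy ⟨h, (hrange _).2 ⟨y, rfl⟩⟩
  · intro x hx
    exact (hrange x).1 (Set.indicator_apply_ne_zero.1 hx).1.2

/-- A Riemann sum for `x ↦ capHeight (e x)`, whose integral is `I / e ^ d` by scaling. The missing
origin costs only `1 / N ^ d`, which vanishes since `d > 0`. -/
theorem tendsto_capSum_div {d : ℕ} (hd : 0 < d) {e : ℕ} (he : 0 < e) :
    Tendsto (fun N : ℕ => capSum d N e / N ^ d) atTop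
      (𝓝 ((∫ x : Fin d → ℝ, capHeight x) / e ^ d)) := by
  have he' : (1 : ℝ) ≤ e := Nat.one_le_cast.2 he
  have h := tendsto_tsum_div_pow (d := d) (fun x => capHeight ((e : ℝ) • x))
    (continuous_capHeight.comp (continuous_const_smul _)) (fun x hx => by
      refine capHeight_eq_zero (not_lt.1 fun h => ?_)
      have h1 : ‖(e : ℝ) • x‖ ≤ 1 := (pi_norm_le_iff_of_nonneg zero_le_one).2 fun i =>
        (abs_apply_lt_one_of_dotProduct_lt_one h i).le
      rw [norm_smul, Real.norm_of_nonneg (by linarith)] at h1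
      nlinarith)
  rw [Measure.integral_comp_smul] at h
  have h1 : Tendsto (fun N : ℕ => (1 : ℝ) / N ^ d) atTop (𝓝 0) := by
    simp only [one_div]
    exact tendsto_inv_atTop_zero.comp
      ((tendsto_pow_atTop hd.ne').comp tendsto_natCast_atTop_atTop)
  have h2 := h.sub h1
  have h3 : |((e : ℝ) ^ Module.finrank ℝ (Fin d → ℝ))⁻¹| • (∫ x : Fin d → ℝ, capHeight x) - 0 =
      (∫ x : Fin d → ℝ, capHeight x) / e ^ d := by
    rw [Module.finrank_fin_fun, abs_of_nonneg (by positivity), smul_eq_mul, sub_zero, div_eq_inv_mul]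
  rw [h3] at h2
  refine h2.congr' ?_
  filter_upwards [eventually_gt_atTop 0] with N hN
  rw [tsum_capHeight_eq hN he]
  ring

/-- The limit is taken term by term in the Möbius sum. The factor `1 / e` from the coprime density
and `1 / e ^ d` from the sublattice combine to `1 / e ^ (d + 1)`, which is summable. -/
theorem tendsto_sum_capHeight_div {d : ℕ} (hd : 0 < d) :
    Tendsto (fun N : ℕ => (∑ z ∈ puncturedBall d N,
        capHeight (scaledVec N z) * coprimeDensity (gcdVec z)) / N ^ d) atTop
      (𝓝 ((∫ x : Fin d → ℝ, capHeight x) *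
        ∑' e : ℕ, (ArithmeticFunction.moebius e : ℝ) / (e : ℝ) ^ (d + 1))) := by
  have hsum : Summable fun e : ℕ => (3 : ℝ) ^ d / (e : ℝ) ^ (d + 1) := by
    simp only [div_eq_mul_inv]
    exact (Real.summable_nat_pow_inv.2 (by omega)).mul_left _
  have h := tendsto_tsum_of_dominated_convergence (𝓕 := atTop)
    (f := fun N e : ℕ => (ArithmeticFunction.moebius e : ℝ) / e * (capSum d N e / (N : ℝ) ^ d))
    (g := fun e : ℕ => (∫ x : Fin d → ℝ, capHeight x) *
      ((ArithmeticFunction.moebius e : ℝ) / (e : ℝ) ^ (d + 1))) hsum ?_ ?_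
  · rw [tsum_mul_left] at h
    refine h.congr fun N => ?_
    rw [sum_capHeight_mul_coprimeDensity, ← tsum_div_const]
    exact tsum_congr fun e => mul_div_assoc _ _ _ |>.symm
  · intro e
    rcases Nat.eq_zero_or_pos e with rfl | he
    · simp
    have h1 := (tendsto_capSum_div hd he).const_mul ((ArithmeticFunction.moebius e : ℝ) / e)
    convert h1 using 2
    rw [pow_succ]
    field_simp
  · filter_upwards [eventually_gt_atTop 0] with N hN e
    rcases Nat.eq_zero_or_pos e with rfl | he
    · simp
    have hmu : |(ArithmeticFunction.moebius e : ℝ)| ≤ 1 := by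
      rw [← Int.cast_abs]
      exact_mod_cast ArithmeticFunction.abs_moebius_le_one
    have he' : (0 : ℝ) < e := Nat.cast_pos.2 he
    have h1 := capSum_div_le (d := d) hN he
    have h2 : 0 ≤ capSum d N e / (N : ℝ) ^ d := div_nonneg (capSum_nonneg _ _ _) (by positivity)
    rw [Real.norm_eq_abs, abs_mul, abs_div, Nat.abs_cast, abs_of_nonneg h2]
    calc |(ArithmeticFunction.moebius e : ℝ)| / e * (capSum d N e / (N : ℝ) ^ d)
        ≤ 1 / e * (3 ^ d / e ^ d) := by gcongr
      _ = _ := by rw [pow_succ]; field_simp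

/-! ### The Möbius series and the zeta function -/

theorem tsum_moebius_mul_riemannZeta {n : ℕ} (hn : 1 < n) :
    (∑' e : ℕ, (ArithmeticFunction.moebius e : ℝ) / (e : ℝ) ^ n) * (riemannZeta (n : ℂ)).re = 1 := by
  have hs : 1 < ((n : ℂ)).re := by
    rw [Complex.natCast_re]
    exact_mod_cast hn
  have h := ArithmeticFunction.LSeries_zeta_mul_Lseries_moebius hs
  rw [ArithmeticFunction.LSeries_zeta_eq_riemannZeta hs] at h
  have h1 : LSeries (fun k => ((ArithmeticFunction.moebius k : ℤ) : ℂ)) n =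
      ((∑' e : ℕ, (ArithmeticFunction.moebius e : ℝ) / (e : ℝ) ^ n : ℝ) : ℂ) := by
    rw [LSeries, Complex.ofReal_tsum]
    refine tsum_congr fun e => ?_
    rcases eq_or_ne e 0 with rfl | he
    · simp
    · rw [LSeries.term_of_ne_zero he]
      simp
  rw [h1] at h
  have h2 := congrArg Complex.re h
  rw [Complex.re_mul_ofReal, Complex.one_re] at h2
  rw [mul_comm]
  exact h2

theorem riemannZeta_natCast_re_pos {n : ℕ} (hn : 1 < n) : 0 < (riemannZeta (n : ℂ)).re := by
  have h1 : riemannZeta (n : ℂ) = ((∑' k : ℕ, 1 / (k : ℝ) ^ n : ℝ) : ℂ) := by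
    rw [zeta_nat_eq_tsum_of_gt_one hn, Complex.ofReal_tsum]
    exact tsum_congr fun k => by simp
  rw [h1, Complex.ofReal_re]
  exact (Real.summable_one_div_nat_pow.2 hn).tsum_pos (fun k => by positivity) 1 (by simp)

/-! ### Building admissible matrices from plank-avoiding points -/

theorem exists_gcdVec_eq_one {d : ℕ} {z : Fin d → ℤ} (hz : z ≠ 0) :
    ∃ (g : ℤ) (w : Fin d → ℤ), 1 ≤ g ∧ gcdVec w = 1 ∧ ∀ i, z i = g * w i := by
  have hg := gcdVec_ne_zero hz
  have hg' : (gcdVec z : ℤ) ≠ 0 := by exact_mod_cast hg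
  choose w hw using fun i => dvd_gcdVec_iff.1 (dvd_refl (gcdVec z)) i
  refine ⟨gcdVec z, w, by exact_mod_cast Nat.one_le_iff_ne_zero.2 hg, ?_, hw⟩
  have h1 : gcdVec z * gcdVec w ∣ gcdVec z := dvd_gcdVec_iff.2 fun i => by
    rw [hw i, Nat.cast_mul]
    exact mul_dvd_mul_left _ (dvd_gcdVec_iff.1 dvd_rfl i)
  exact Nat.dvd_one.1 ((mul_dvd_mul_iff_left hg).1 (by rwa [mul_one]))

/-- To check admissibility it suffices to consider primitive vectors. -/
theorem isAdmissible_of_gcdVec_eq_one {n : ℕ} {T : Matrix (Fin n) (Fin n) ℝ}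
    (h : ∀ w : Fin n → ℤ, gcdVec w = 1 →
      1 ≤ T.mulVec (fun i => (w i : ℝ)) ⬝ᵥ T.mulVec (fun i => (w i : ℝ))) : IsAdmissible T := by
  intro z hz
  obtain ⟨g, w, hg, hw, hzw⟩ := exists_gcdVec_eq_one hz
  have h1 : (fun i => (z i : ℝ)) = (g : ℝ) • fun i => (w i : ℝ) := by
    ext i
    simp [hzw i]
  rw [h1, Matrix.mulVec_smul, smul_dotProduct, dotProduct_smul, smul_eq_mul, smul_eq_mul]
  have hg' : (1 : ℝ) ≤ g := by exact_mod_cast hg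
  nlinarith [h w hw, mul_le_mul hg' hg' zero_le_one (by linarith)]

theorem scaledVec_dotProduct_comp_perm {d N : ℕ} (σ : Equiv.Perm (Fin d)) (z : Fin d → ℤ) :
    scaledVec N (z ∘ σ) ⬝ᵥ scaledVec N (z ∘ σ) = scaledVec N z ⬝ᵥ scaledVec N z := by
  simp only [scaledVec, dotProduct, Function.comp]
  exact Equiv.sum_comp σ fun i => (z i : ℝ) / N * (z i / N)

theorem scaledVec_dotProduct_update_neg {d N : ℕ} (i : Fin d) (z : Fin d → ℤ) :
    scaledVec N (Function.update z i (-z i)) ⬝ᵥ scaledVec N (Function.update z i (-z i)) =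
      scaledVec N z ⬝ᵥ scaledVec N z := by
  simp only [scaledVec, dotProduct]
  refine Finset.sum_congr rfl fun j _ => ?_
  by_cases h : j = i
  · subst h
    simp [neg_div]
  · rw [Function.update_of_ne h]

/-- The matrix of `(z, k) ↦ (z / N, β (⟨q, z⟩ + k))`. -/
noncomputable def shearMatrix {d : ℕ} (N : ℕ) (β : ℝ) (q : Fin d → ℝ) :
    Matrix (Fin (d + 1)) (Fin (d + 1)) ℝ :=
  Matrix.of (Fin.snoc (fun i => Fin.snoc (Pi.single i ((N : ℝ)⁻¹)) 0)
    (Fin.snoc (β • q) β : Fin (d + 1) → ℝ) : Fin (d + 1) → Fin (d + 1) → ℝ)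

theorem det_shearMatrix {d : ℕ} (N : ℕ) (β : ℝ) (q : Fin d → ℝ) :
    (shearMatrix N β q).det = (N : ℝ)⁻¹ ^ d * β := by
  rw [Matrix.det_of_isLowerTriangular, Fin.prod_univ_castSucc]
  · simp [shearMatrix]
  · intro i j hij
    rw [OrderDual.toDual_lt_toDual] at hij
    induction i using Fin.lastCases with
    | last => exact absurd hij (not_lt.2 (Fin.le_last j))
    | cast i =>
      induction j using Fin.lastCases with
      | last => simp [shearMatrix]
      | cast j =>
        have : j ≠ i := fun h => by simp [h] at hij
        simp [shearMatrix, this]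

theorem shearMatrix_mulVec_dotProduct {d : ℕ} (N : ℕ) (β : ℝ) (q : Fin d → ℝ)
    (w : Fin (d + 1) → ℤ) :
    (shearMatrix N β q).mulVec (fun i => (w i : ℝ)) ⬝ᵥ
        (shearMatrix N β q).mulVec (fun i => (w i : ℝ)) =
      scaledVec N (fun i => w i.castSucc) ⬝ᵥ scaledVec N (fun i => w i.castSucc) +
        (β * ((q ⬝ᵥ fun i => (w i.castSucc : ℝ)) + w (Fin.last d))) ^ 2 := by
  have h1 : ∀ i : Fin d, (shearMatrix N β q).mulVec (fun i => (w i : ℝ)) i.castSucc =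
      scaledVec N (fun i => w i.castSucc) i := by
    intro i
    simp [shearMatrix, Matrix.mulVec, dotProduct, Fin.sum_univ_castSucc, Pi.single_apply,
      scaledVec, div_eq_inv_mul]
  have h2 : (shearMatrix N β q).mulVec (fun i => (w i : ℝ)) (Fin.last d) =
      β * ((q ⬝ᵥ fun i => (w i.castSucc : ℝ)) + w (Fin.last d)) := by
    simp [shearMatrix, Matrix.mulVec, dotProduct, Fin.sum_univ_castSucc, mul_add,
      Finset.mul_sum, mul_assoc]
  rw [dotProduct, Fin.sum_univ_castSucc, h2, sq]
  simp only [h1]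
  rfl

/-- Admissible matrices exist for every determinant above the threshold given by Bang's lemma. -/
theorem exists_isAdmissible_det_eq {d : ℕ} (hd : 0 < d) {D : ℝ} (hD0 : 0 < D)
    (hD : (∫ x : Fin d → ℝ, capHeight x) *
      (∑' e : ℕ, (ArithmeticFunction.moebius e : ℝ) / (e : ℝ) ^ (d + 1)) < d * D) :
    ∃ T : Matrix (Fin (d + 1)) (Fin (d + 1)) ℝ, IsAdmissible T ∧ T.det = D := by
  have hlarge : Tendsto (fun N : ℕ => D * (N : ℝ) ^ d) atTop atTop :=
    ((tendsto_pow_atTop hd.ne').comp tendsto_natCast_atTop_atTop).const_mul_atTop hD0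
  -- One large `N` makes the plank sum small enough and `β = D N ^ d` at least 1. The latter gives
  -- `η z ≤ 1` and handles the vectors `(0, ±1)`, whose images have length `β`.
  obtain ⟨N, hS, hβ, hN⟩ := ((tendsto_sum_capHeight_div hd).eventually (gt_mem_nhds hD)
    |>.and ((hlarge.eventually_ge_atTop 1).and (eventually_gt_atTop 0))).exists
  have hN' : (0 : ℝ) < N := Nat.cast_pos.2 hN
  set β := D * (N : ℝ) ^ d with hβdef
  have hβ0 : 0 < β := by positivity
  have hmem : ∀ z, z ∈ puncturedBall d N ↔ z ≠ 0 ∧ scaledVec N z ⬝ᵥ scaledVec N z < 1 :=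
    fun z => mem_puncturedBall hN
  obtain ⟨q, hq⟩ := exists_forall_le_abs_dotProduct_add hd (puncturedBall d N)
    (fun h => ne_zero_of_mem_puncturedBall h rfl) (fun z => capHeight (scaledVec N z) / β)
    (fun z hz => ⟨div_pos (Real.sqrt_pos.2 (sub_pos.2 ((hmem z).1 hz).2)) hβ0,
      (div_le_one hβ0).2 ((capHeight_le_one _).trans hβ)⟩)
    (fun z hz => by
      have : scaledVec N (-z) ⬝ᵥ scaledVec N (-z) = scaledVec N z ⬝ᵥ scaledVec N z := by
        simp [scaledVec, dotProduct, neg_div]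
      rw [hmem] at hz ⊢
      exact ⟨⟨neg_ne_zero.2 hz.1, by rw [this]; exact hz.2⟩, by simp only [capHeight, this]⟩)
    (fun σ z hz => by
      have := scaledVec_dotProduct_comp_perm (N := N) σ z
      rw [hmem] at hz ⊢
      refine ⟨⟨fun h => hz.1 ?_, by rw [this]; exact hz.2⟩, by simp only [capHeight, this]⟩
      ext i
      simpa using congrFun h (σ.symm i))
    (fun i z hz => by
      have := scaledVec_dotProduct_update_neg (N := N) i z
      rw [hmem] at hz ⊢
      refine ⟨⟨fun h => hz.1 ?_, by rw [this]; exact hz.2⟩, by simp only [capHeight, this]⟩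
      ext j
      by_cases hj : j = i
      · subst hj
        simpa using congrFun h j
      · simpa [Function.update_of_ne hj] using congrFun h j)
    (by
      simp only [div_mul_eq_mul_div, ← Finset.sum_div]
      rw [div_lt_iff₀ hβ0, hβdef, ← mul_assoc, ← div_lt_iff₀ (by positivity)]
      exact hS)
  refine ⟨shearMatrix N β q, isAdmissible_of_gcdVec_eq_one fun w hw => ?_, ?_⟩
  · rw [shearMatrix_mulVec_dotProduct]
    set w' : Fin d → ℤ := fun i => w i.castSucc with hw'
    set X := scaledVec N w' ⬝ᵥ scaledVec N w' with hX
    have hX0 : 0 ≤ X := Finset.sum_nonneg fun i _ => mul_self_nonneg _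
    have hcop : ∀ e : ℕ, (e : ℤ) ∣ w (Fin.last d) → e ∣ gcdVec w' → e = 1 := by
      intro e h1 h2
      rw [← Nat.dvd_one, ← hw, dvd_gcdVec_iff]
      intro i
      induction i using Fin.lastCases with
      | last => exact h1
      | cast i => exact dvd_gcdVec_iff.1 h2 i
    -- Three cases: a primitive vector with `w' = 0` has last entry `±1`; if `|w' / N| ≥ 1` the
    -- first `d` coordinates suffice; otherwise the plank inequality bounds the last coordinate of
    -- the image.
    by_cases hw0 : w' = 0
    · have hk : (w (Fin.last d)).natAbs = 1 := hcop _ (by simp) (by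
        rw [hw0]
        exact dvd_gcdVec_iff.2 fun i => by simp)
      have hk2 : (w (Fin.last d) : ℝ) ^ 2 = 1 := by
        rcases Int.natAbs_eq (w (Fin.last d)) with h | h <;> rw [h, hk] <;> simp
      have h0 : (q ⬝ᵥ fun i => (w' i : ℝ)) = 0 := by simp [hw0, dotProduct]
      rw [h0, zero_add, mul_pow, hk2]
      nlinarith
    rcases le_or_gt 1 X with h1 | h1
    · nlinarith [sq_nonneg (β * ((q ⬝ᵥ fun i => (w' i : ℝ)) + w (Fin.last d)))]
    · have h2 := hq w' ((hmem w').2 ⟨hw0, h1⟩) (w (Fin.last d))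
        (hcop _ (Int.natCast_dvd.2 (Nat.gcd_dvd_left _ _)) (Nat.gcd_dvd_right _ _))
      rw [div_le_iff₀' hβ0] at h2
      have h3 : (1 - X) ≤ (β * |(q ⬝ᵥ fun i => (w' i : ℝ)) + w (Fin.last d)|) ^ 2 := by
        rw [← Real.sq_sqrt (sub_nonneg.2 h1.le)]
        exact pow_le_pow_left₀ (Real.sqrt_nonneg _) h2 2
      rw [mul_pow, sq_abs, ← mul_pow] at h3
      linarith
  · rw [det_shearMatrix, hβdef, inv_pow]
    field_simp

/-! ### Volume of the unit ball -/

theorem integrable_capHeight {d : ℕ} : Integrable (capHeight (d := d)) := by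
  refine continuous_capHeight.integrable_of_hasCompactSupport
    (HasCompactSupport.of_support_subset_isCompact (isCompact_closedBall 0 1) fun x hx => ?_)
  rw [mem_closedBall_zero_iff, pi_norm_le_iff_of_nonneg zero_le_one]
  by_contra h
  refine hx (capHeight_eq_zero (not_lt.1 fun h1 => h fun i => ?_))
  exact (abs_apply_lt_one_of_dotProduct_lt_one h1 i).le

/-- The volume of the unit ball as twice the integral of its height function. -/
theorem volume_real_ball_eq_two_mul_integral (d : ℕ) :
    volume.real (Metric.ball (0 : EuclideanSpace ℝ (Fin (d + 1))) 1) =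
      2 * ∫ x : Fin d → ℝ, capHeight x := by
  -- Splitting off the last coordinate preserves volume and turns the ball into the region between
  -- the graphs of `-capHeight` and `capHeight`.
  have hφ := (Measure.measurePreserving_swap (μ := (volume : Measure ℝ))
    (ν := (volume : Measure (Fin d → ℝ)))).comp
    ((volume_preserving_piFinSuccAbove (fun _ : Fin (d + 1) => ℝ) (Fin.last d)).comp
      (EuclideanSpace.volume_preserving_symm_measurableEquiv_toLp (Fin (d + 1))))
  have hpre := hφ.measure_preimage (measurableSet_regionBetween
    (continuous_capHeight (d := d)).measurable.neg continuous_capHeight.measurable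
    MeasurableSet.univ).nullMeasurableSet
  have hset : Metric.ball (0 : EuclideanSpace ℝ (Fin (d + 1))) 1 =
      (Prod.swap ∘ (MeasurableEquiv.piFinSuccAbove (fun _ : Fin (d + 1) => ℝ) (Fin.last d)) ∘
        (MeasurableEquiv.toLp 2 (Fin (d + 1) → ℝ)).symm) ⁻¹'
        regionBetween (-capHeight) capHeight Set.univ := by
    ext x
    have h1 : (x ∈ Metric.ball (0 : EuclideanSpace ℝ (Fin (d + 1))) 1) ↔
        ∑ i : Fin d, x i.castSucc ^ 2 + x (Fin.last d) ^ 2 < 1 := by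
      rw [mem_ball_zero_iff, ← sq_lt_one_iff₀ (norm_nonneg x), EuclideanSpace.real_norm_sq_eq,
        Fin.sum_univ_castSucc]
    have h2 : (fun i : Fin d => x i.castSucc) ⬝ᵥ (fun i : Fin d => x i.castSucc) =
        ∑ i : Fin d, x i.castSucc ^ 2 := by simp only [dotProduct, sq]
    have h3 : x ∈ (Prod.swap ∘ (MeasurableEquiv.piFinSuccAbove (fun _ : Fin (d + 1) => ℝ)
        (Fin.last d)) ∘ (MeasurableEquiv.toLp 2 (Fin (d + 1) → ℝ)).symm) ⁻¹'
        regionBetween (-capHeight) capHeight Set.univ ↔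
        |x (Fin.last d)| < capHeight fun i : Fin d => x i.castSucc := by
      rw [abs_lt]
      simp [regionBetween, MeasurableEquiv.piFinSuccAbove]
      rfl
    rw [h1, h3, capHeight, h2, Real.lt_sqrt (abs_nonneg _), sq_abs]
    constructor <;> intro h <;> linarith
  rw [measureReal_def, hset, hpre, volume_regionBetween_eq_integral
    integrable_capHeight.neg.integrableOn integrable_capHeight.integrableOn MeasurableSet.univ
    (fun x _ => (neg_nonpos.2 (capHeight_nonneg x)).trans (capHeight_nonneg x)),
    setIntegral_univ, ENNReal.toReal_ofReal]
  · rw [← integral_const_mul]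
    congr 1
    ext x
    simp only [Pi.sub_apply, Pi.neg_apply]
    ring
  · refine integral_nonneg fun x => ?_
    simp only [Pi.sub_apply, Pi.neg_apply, Pi.zero_apply]
    linarith [capHeight_nonneg x]

theorem volume_real_closedBall_half {n : ℕ} :
    volume.real (Metric.closedBall (0 : EuclideanSpace ℝ (Fin n)) (1 / 2)) =
      (2 : ℝ) ^ (-(n : ℤ)) * volume.real (Metric.ball (0 : EuclideanSpace ℝ (Fin n)) 1) := by
  rw [Measure.addHaar_real_closedBall _ _ (by norm_num), finrank_euclideanSpace_fin]
  simp

/-! ### Assembly -/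

/-- In dimension one the unit intervals centred at the integers have density one. -/
theorem exists_packing_dim_one : ∃ P : LatticeSpherePacking 1, P.HasDensity 1 := by
  have hadm : IsAdmissible (1 : Matrix (Fin 1) (Fin 1) ℝ) := by
    intro z hz
    have h0 : z 0 ≠ 0 := fun h => hz (by ext i; rw [Subsingleton.elim i 0, h]; rfl)
    simp only [Matrix.one_mulVec, dotProduct, Fin.sum_univ_one, ← sq]
    rw [one_le_sq_iff_one_le_abs, ← Int.cast_abs]
    exact_mod_cast Int.one_le_abs h0
  obtain ⟨P, hP⟩ := exists_packing_of_isAdmissible le_rfl 1 (by simp) hadm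
  refine ⟨P, ?_⟩
  convert hP using 1
  rw [volume_real_closedBall_half, volume_real_ball_eq_two_mul_integral 0, integral_unique]
  simp [capHeight, measureReal_def, volume_pi]

/-- Determinants `D + 1 / (j + 1)` decrease to the threshold `D = I Z / d`, where `Z = 1 / ζ(d +
1)`. Compactness attains `D` itself, so the density equals the bound. -/
theorem exists_packing_dim_succ {d : ℕ} (hd : 0 < d) :
    ∃ P : LatticeSpherePacking (d + 1), P.HasDensity
      (2 * d * (2 : ℝ) ^ (-((d + 1 : ℕ) : ℤ)) * (riemannZeta ((d + 1 : ℕ) : ℂ)).re) := by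
  have hdR : (0 : ℝ) < d := Nat.cast_pos.2 hd
  set I := ∫ x : Fin d → ℝ, capHeight x
  set Z := ∑' e : ℕ, (ArithmeticFunction.moebius e : ℝ) / (e : ℝ) ^ (d + 1)
  have hvol := volume_real_ball_eq_two_mul_integral d
  have hI : 0 < I := by
    have : 0 < volume.real (Metric.ball (0 : EuclideanSpace ℝ (Fin (d + 1))) 1) :=
      ENNReal.toReal_pos (Metric.measure_ball_pos _ _ one_pos).ne' measure_ball_lt_top.ne
    linarith
  have hZζ : Z * (riemannZeta ((d + 1 : ℕ) : ℂ)).re = 1 :=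
    tsum_moebius_mul_riemannZeta (by omega)
  have hζ := riemannZeta_natCast_re_pos (n := d + 1) (by omega)
  have hZ : 0 < Z := pos_of_mul_pos_left (by rw [hZζ]; exact one_pos) hζ.le
  set D := I * Z / d with hD
  have hD0 : 0 < D := by positivity
  have hT : ∀ j : ℕ, ∃ T : Matrix (Fin (d + 1)) (Fin (d + 1)) ℝ,
      IsAdmissible T ∧ T.det = D + 1 / ((j : ℝ) + 1) := by
    intro j
    have hj : (0 : ℝ) < 1 / ((j : ℝ) + 1) := by positivity
    refine exists_isAdmissible_det_eq hd (by linarith) ?_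
    rw [mul_add, hD, mul_div_cancel₀ _ hdR.ne']
    exact lt_add_of_pos_right _ (by positivity)
  choose T hadm hdet using hT
  obtain ⟨B, hB, hBdet⟩ := exists_isAdmissible_abs_det_eq hadm hD0 (by
    simp only [hdet]
    simpa using (tendsto_one_div_add_atTop_nhds_zero_nat (𝕜 := ℝ)).const_add D)
  obtain ⟨P, hP⟩ := exists_packing_of_isAdmissible (by omega) B
    (fun h => by rw [h, abs_zero] at hBdet; exact hD0.ne hBdet) hB
  refine ⟨P, ?_⟩
  convert hP using 1
  rw [hBdet, volume_real_closedBall_half, hvol, eq_div_iff hD0.ne', hD]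
  field_simp
  linear_combination I * hZζ

theorem mainTheorem11 (n : ℕ) (hn : 1 ≤ n) :
    ∃ (P : LatticeSpherePacking n) (δ : ℝ), P.HasDensity δ ∧
      2 * ((n : ℝ) - 1) * (2 : ℝ) ^ (-(n : ℤ)) * (riemannZeta (n : ℂ)).re ≤ δ ∧
      (n = 1 → 1 ≤ δ) := by
  rcases hn.eq_or_lt with rfl | h
  -- The factor `n - 1` is zero here, so the first bound holds whatever value `riemannZeta` takes at
  -- 1; the last clause carries the content.
  · obtain ⟨P, hP⟩ := exists_packing_dim_one
    exact ⟨P, 1, hP, by simp, fun _ => le_rfl⟩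
  · obtain ⟨d, rfl⟩ : ∃ d, n = d + 1 := ⟨n - 1, by omega⟩
    obtain ⟨P, hP⟩ := exists_packing_dim_succ (d := d) (by omega)
    exact ⟨P, _, hP, by simp, by omega⟩
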